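/- **Setting.** Let $\Omega\subseteq\mathbb R^3$ be open, $[0,T_e)$ a time interval, $b\in\mathbb R^3$, $\tilde\alpha\in C(\mathbb S^2\times\mathbb R^3,\mathbb R^3)$, and let $T$ assign to each $t\in[0,T_e)$ a field $T(t)\in C(\overline\Omega,\mathcal S^3)$ of symmetric $3\times 3$ matrices. *Dislocation measures.* A vector-valued dislocation measure on $\Omega$ is a measure $\rho=\tau\mu$, where $\mu=|\rho|$ is a nonnegative Radon measure on $\Omega$, $\tau=\rho/|\rho|\in C(\operatorname{supp}\mu,\mathbb R^3)$ satisfies $|\tau|=1$, and $\rho=\operatorname{rot}h$ in the sense of distributions for some $h\in L^{1,\mathrm{loc}}(\Omega,\mathbb R^3)$; $\langle\beta\mu,\varphi\rangle=\int\beta\cdot\varphi\,d\mu$. A family $\rho(t)$, $t\in[0,T_e)$, of dislocation measures solves $$\partial_t\rho=\operatorname{rot}_x\Big(\tilde\alpha\big(\tfrac{\rho}{|\rho|},\tfrac{\rho}{|\rho|}\times Tb\big)\times\rho\Big)\qquad(1)$$ if for all $\varphi\in C_0^\infty((0,T_e)\times\Omega,\mathbb R^3)$ the following integrals exist and $$-\int_0^{T_e}\langle\rho(t),\partial_t\varphi(t)\rangle\,dt=\int_0^{T_e}\Big\langle\tilde\alpha\big(\tfrac{\rho}{|\rho|},\tfrac{\rho}{|\rho|}\times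 Tb\big)\times\rho,\ \operatorname{rot}_x\varphi(t)\Big\rangle\,dt .$$ *Moving curve.* Let $\ell(t)\subseteq\Omega$, $t\in[0,T_e)$, be a moving embedded $C^1$ curve with oriented unit tangent $\tau(x,t)$: each $\ell(t)$ is relatively closed in $\Omega$, and near every $x_0\in\ell(t_0)$, for $t$ near $t_0$ in $[0,T_e)$, it is given by a map $\gamma(s,t)$ that is jointly $C^1$, with $s\mapsto\gamma(s,t)$ an injective, regular, positively oriented parametrization on a compact interval having $x_0=\gamma(s_0,t_0)$ for an interior $s_0$. (Closed curves, infinite lines, curves ending on $\partial\Omega$, and several components are allowed.) Its dislocation measure for the Burgers vector $b$ is $\rho_{\ell(t)}=\tau\,|\rho_{\ell(t)}|$ with $|\rho_{\ell(t)}|=|b|\,\mathcal H^1\lfloor\ell(t)$. *Normal velocity.* For $x_0\in\ell(t_0)$ let $\xi(t)$ be, for $t$ near $t_0$ in $[0,T_e)$, the intersection point near $x_0$ of $\ell(t)$ with the plane through $x_0$ orthogonal to $\tau(x_0,t_0)$. The normal velocity is $v(x_0,t_0)=\xi'(t_0)$ (one-sided if $t_0=0$). Write $\operatorname{proj}_\tau$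 for the orthogonal projection of $\mathbb R^3$ onto $\{\xi:\xi\cdot\tau=0\}$. **Corollary 3.4.** Suppose $\rho_{\ell(t)}$ solves (1). Let $t\in[0,T_e)$ and $x\in\ell(t)$ be such that $\tau(x,t)$ is not parallel to $b$ (that is, $b\notin\mathbb R\,\tau(x,t)$), that $T$, as a function on $\Omega\times[0,T_e)$, is continuous at $(x,t)$ (which holds in particular if $T\in C([0,T_e]\times\overline\Omega,\mathcal S^3)$), and that $$b\cdot\Big(\tilde\alpha\big(\tau(x,t),\tau(x,t)\times T(x,t)b\big)\times\tau(x,t)\Big)=0 .$$ Then the normal velocity $v(x,t)$ exists and is parallel to $\operatorname{proj}_{\tau(x,t)}b$, i.e. $v(x,t)\in\mathbb R\operatorname{proj}_{\tau(x,t)}b$. -/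

import Mathlib

open Set Filter Topology MeasureTheory

noncomputable section

/-- Euclidean three-space. -/
abbrev E3 : Type := EuclideanSpace ℝ (Fin 3)

/-- The vector product on Euclidean three-space. -/
def cross (u v : E3) : E3 := WithLp.toLp 2 (crossProduct u.ofLp v.ofLp)

/-- Application of a `3 × 3` matrix to a vector. -/
def matVec (A : Matrix (Fin 3) (Fin 3) ℝ) (v : E3) : E3 := WithLp.toLp 2 (A.mulVec v.ofLp)

/-- `partialD i j φ x` is the partial derivative at `x`, in direction `i`, of the `j`-th
component of `φ`. -/
def partialD (i j : Fin 3) (φ : E3 → E3) (x : E3) : ℝ :=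
  (fderiv ℝ φ x (EuclideanSpace.single i 1)) j

/-- The rotation (curl) of a differentiable vector field. -/
def rot (φ : E3 → E3) (x : E3) : E3 :=
  !₂[partialD 1 2 φ x - partialD 2 1 φ x,
     partialD 2 0 φ x - partialD 0 2 φ x,
     partialD 0 1 φ x - partialD 1 0 φ x]

/-- The pairing `⟨β μ, φ⟩ = ∫ β · φ dμ` of the vector valued measure `β μ` with a vector field. -/
def pairing (μ : Measure E3) (β φ : E3 → E3) : ℝ := ∫ x, inner ℝ (β x) (φ x) ∂μ

/-- Test fields `C₀^∞(Ω, ℝ³)`. -/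
structure IsTestField (Ω : Set E3) (φ : E3 → E3) : Prop where
  smooth : ContDiff ℝ ((⊤ : ℕ∞) : WithTop ℕ∞) φ
  compact : HasCompactSupport φ
  supp : tsupport φ ⊆ Ω

/-- Space-time test fields `C₀^∞((0, Te) × Ω, ℝ³)`. -/
structure IsSpaceTimeTestField (Te : ℝ) (Ω : Set E3) (φ : ℝ → E3 → E3) : Prop where
  smooth : ContDiff ℝ ((⊤ : ℕ∞) : WithTop ℕ∞) (Function.uncurry φ)
  compact : HasCompactSupport (Function.uncurry φ)
  supp : tsupport (Function.uncurry φ) ⊆ Ioo 0 Te ×ˢ Ω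

/-- `τ μ` is a vector valued dislocation measure on the open set `Ω`: `μ` is a nonnegative Radon
measure on `Ω` (extended by zero to the whole space), `τ` is a continuous field of unit vectors on
the support of `μ`, and `τ μ = rot h` in the sense of distributions on `Ω` for some
`h ∈ L^{1,loc}(Ω, ℝ³)`. -/
structure IsDislocationMeasure (Ω : Set E3) (μ : Measure E3) (τ : E3 → E3) : Prop where
  radon : ∀ K : Set E3, IsCompact K → K ⊆ Ω → μ K < ⊤
  concentrated : μ Ωᶜ = 0
  continuousOn : ContinuousOn τ (μ.support ∩ Ω)
  unit : ∀ x ∈ μ.support ∩ Ω, ‖τ x‖ = 1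
  exists_rot : ∃ h : E3 → E3, LocallyIntegrableOn h Ω volume ∧
    ∀ φ : E3 → E3, IsTestField Ω φ →
      pairing (volume.restrict Ω) h (rot φ) = pairing μ τ φ

/-- The vector `α̃(τ, τ × T b)`, for given values of the unit vector `τ` and of the stress `T`. -/
def constitutive (α : E3 → E3 → E3) (b : E3) (T : Matrix (Fin 3) (Fin 3) ℝ) (τ : E3) : E3 :=
  α τ (cross τ (matVec T b))

/-- The time dependent dislocation measure `ρ(t) = τ(t) μ(t)`, `t ∈ [0, Te)`, is a weak solution of
`∂ₜ ρ = rot (α̃(ρ/|ρ|, ρ/|ρ| × T b) × ρ)` on `Ω`, where `|ρ| = μ` and `ρ/|ρ| = τ`: for every test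
field all integrals exist and the integral identity holds. -/
structure IsWeakSolution (Ω : Set E3) (Te : ℝ) (α : E3 → E3 → E3) (b : E3)
    (T : ℝ → E3 → Matrix (Fin 3) (Fin 3) ℝ) (μ : ℝ → Measure E3) (τ : ℝ → E3 → E3) : Prop where
  isDislocationMeasure : ∀ t ∈ Ico 0 Te, IsDislocationMeasure Ω (μ t) (τ t)
  integrable_left : ∀ φ : ℝ → E3 → E3, IsSpaceTimeTestField Te Ω φ → ∀ t ∈ Ioo 0 Te,
    Integrable (fun x => inner ℝ (τ t x) (deriv (fun r => φ r x) t)) (μ t)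
  integrable_right : ∀ φ : ℝ → E3 → E3, IsSpaceTimeTestField Te Ω φ → ∀ t ∈ Ioo 0 Te,
    Integrable
      (fun x => inner ℝ (cross (constitutive α b (T t x) (τ t x)) (τ t x)) (rot (φ t) x)) (μ t)
  integrableOn_left : ∀ φ : ℝ → E3 → E3, IsSpaceTimeTestField Te Ω φ →
    IntegrableOn (fun t => pairing (μ t) (τ t) (fun x => deriv (fun r => φ r x) t)) (Ioo 0 Te)
  integrableOn_right : ∀ φ : ℝ → E3 → E3, IsSpaceTimeTestField Te Ω φ →
    IntegrableOn (fun t => pairing (μ t)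
      (fun x => cross (constitutive α b (T t x) (τ t x)) (τ t x)) (rot (φ t))) (Ioo 0 Te)
  equation : ∀ φ : ℝ → E3 → E3, IsSpaceTimeTestField Te Ω φ →
    -∫ t in Ioo 0 Te, pairing (μ t) (τ t) (fun x => deriv (fun r => φ r x) t) =
      ∫ t in Ioo 0 Te, pairing (μ t)
        (fun x => cross (constitutive α b (T t x) (τ t x)) (τ t x)) (rot (φ t))

/-- `ℓ(t)`, `t ∈ [0, Te)`, is a moving embedded `C¹` curve in `Ω` without end points in `Ω`, and
`τ(t)` is its oriented unit tangent field. Every `ℓ(t)` is closed relative to `Ω`, and near each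
of its points the family is given by a `C¹` map `γ(s, t)` such that `s ↦ γ(s, t)` is a regular,
injective, positively oriented parametrization of `ℓ(t)`; the parameter interval is compact, hence
self-contact is excluded. The time variable ranges over a
neighbourhood relative to `[0, Te)`. Closed curves, infinite lines and curves
that end on the boundary of `Ω` are included, and several components are allowed. -/
structure IsMovingCurve (Ω : Set E3) (Te : ℝ) (ℓ : ℝ → Set E3) (τ : ℝ → E3 → E3) : Prop where
  subset : ∀ t ∈ Ico 0 Te, ℓ t ⊆ Ω
  relClosed : ∀ t ∈ Ico 0 Te, closure (ℓ t) ∩ Ω ⊆ ℓ t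
  unit : ∀ t ∈ Ico 0 Te, ∀ x ∈ ℓ t, ‖τ t x‖ = 1
  chart : ∀ t₀ ∈ Ico 0 Te, ∀ x₀ ∈ ℓ t₀,
    ∃ U ∈ 𝓝 x₀, ∃ ε > (0 : ℝ), ∃ γ : ℝ × ℝ → E3,
      γ (0, t₀) = x₀ ∧
      ContDiffOn ℝ 1 γ (Icc (-ε) ε ×ˢ (Ioo (t₀ - ε) (t₀ + ε) ∩ Ico 0 Te)) ∧
      ∀ t ∈ Ioo (t₀ - ε) (t₀ + ε) ∩ Ico 0 Te,
        InjOn (fun s => γ (s, t)) (Icc (-ε) ε) ∧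
        (∀ s ∈ Icc (-ε) ε, γ (s, t) ∈ ℓ t) ∧
        (∀ s ∈ Ioo (-ε) ε, ∃ c > (0 : ℝ),
          HasDerivAt (fun r => γ (r, t)) (c • τ t (γ (s, t))) s) ∧
        ℓ t ∩ U ⊆ (fun s => γ (s, t)) '' Icc (-ε) ε

/-- The total variation `|ρ_ℓ| = |b| ℋ¹⌊ℓ` of the dislocation measure `ρ_ℓ = τ |ρ_ℓ|` of a curve
`ℓ` with Burgers vector `b`; thus `⟨ρ_ℓ, φ⟩ = |b| ∫_ℓ τ · φ ds`. -/
def curveMeasure (b : E3) (ℓ : Set E3) : Measure E3 :=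
  ‖b‖₊ • (Measure.hausdorffMeasure 1 : Measure E3).restrict ℓ

/-- The plane through `x₀` that is orthogonal to `n`. -/
def normalPlane (x₀ n : E3) : Set E3 := {y | inner ℝ (y - x₀) n = 0}

/-- `v` is the normal velocity of the family `ℓ(t)` at time `t₀` in the point `x₀ ∈ ℓ(t₀)`: for
times `t` near `t₀` let `ξ(t)` be the intersection point near `x₀` of `ℓ(t)` with the plane through
`x₀` orthogonal to `τ(x₀, t₀)`; then `v = ξ'(t₀)` (one-sided if `t₀ = 0`). -/
def HasNormalVelocity (Te : ℝ) (ℓ : ℝ → Set E3) (τ : ℝ → E3 → E3) (t₀ : ℝ) (x₀ v : E3) : Prop :=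
  ∃ U ∈ 𝓝 x₀, ∃ ξ : ℝ → E3, ξ t₀ = x₀ ∧
    (∀ᶠ t in 𝓝[Ico 0 Te] t₀, ℓ t ∩ normalPlane x₀ (τ t₀ x₀) ∩ U = {ξ t}) ∧
    HasDerivWithinAt ξ v (Ico 0 Te) t₀

/-- The orthogonal projection onto the orthogonal space of the vector `τ`. -/
def projPerp (τ u : E3) : E3 := (Submodule.span ℝ {τ})ᗮ.starProjection u

/-- `u` is parallel to `w`: it lies on the line spanned by `w`. -/
def IsParallelTo (u w : E3) : Prop := u ∈ Submodule.span ℝ {w}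

end

/-! The proof blows up the weak equation at the point `(t₀, x₀)`. A chart is strictly differentiable
there, so to first order the curve is a line of direction `p = c u`, `u` the unit tangent, moving
with velocity `V = ∂ₜγ` (`IsMovingCurve.exists_hasFirstOrderModel`). This line crosses the plane
orthogonal to `u` with velocity `v`, the part of `V` orthogonal to `u`, and the same holds for the
curve (`HasFirstOrderModel.hasNormalVelocity`).

The weak equation is tested with `ε ψ((t - t₀)/ε, (y - x₀)/ε) p`. As `ε → 0` every line integral
approaches its counterpart on the model line, with coefficients frozen at `(t₀, x₀)`
(`HasFirstOrderModel.exists_blowUp_estimate`). The profile `ψ` contains the factor `n · (z - r V)`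
with `n ⊥ u`. It vanishes on the moving line, so only the derivative of this factor survives: `-n ·
V` in time and `n` in space. With `a = α̃(τ, τ × T b)`, the right-hand side contributes `(a × u) ·
(n × p) = c (a · n)`. Hence `n · V = n · a` for every `n ⊥ u` (`IsWeakSolution.inner_velocity_eq`).

For `n = u × b` the triple product gives `n · a = b · (a × u)`, which is zero by assumption. So `v`
is orthogonal to both `u` and `u × b`, and since `b` is not a multiple of `u` it lies on the line of
the projection of `b`. -/

noncomputable section

/-! ### First order models of a moving `C¹` curve -/

/-- To first order at `(t₀, x₀)`, the moving curve `ℓ` is the moving line `s ↦ x₀ + s p + (t - t₀) V`,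
and its tangent field is continuous there. -/
def HasFirstOrderModel (Te : ℝ) (ℓ : ℝ → Set E3) (τ : ℝ → E3 → E3) (t₀ : ℝ) (x₀ p V : E3) : Prop :=
  ∀ η : ℝ, 0 < η → ∃ δ : ℝ, 0 < δ ∧ ∀ t ∈ Ico 0 Te, |t - t₀| < δ → ∃ g : ℝ → E3,
    (∀ s s', ‖g s - g s' - (s - s') • p‖ ≤ η * |s - s'|) ∧
    ‖g 0 - x₀ - (t - t₀) • V‖ ≤ η * |t - t₀| ∧
    ∀ y ∈ Metric.ball x₀ δ, (y ∈ ℓ t ↔ y ∈ range g) ∧ (y ∈ ℓ t → ‖τ t y - τ t₀ x₀‖ ≤ η)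

/-- A `C¹` map on a convex set is strictly differentiable relative to the set. -/
lemma exists_strict_estimate_of_contDiffOn {E F : Type*} [NormedAddCommGroup E] [NormedSpace ℝ E]
    [NormedAddCommGroup F] [NormedSpace ℝ F] {f : E → F} {D : Set E} (hf : ContDiffOn ℝ 1 f D)
    (hD : Convex ℝ D) (hu : UniqueDiffOn ℝ D) {q : E} (hq : q ∈ D) {η : ℝ} (hη : 0 < η) :
    ∃ δ : ℝ, 0 < δ ∧ ∀ a ∈ D, ∀ c ∈ D, dist a q < δ → dist c q < δ →
      ‖f a - f c - fderivWithin ℝ f D q (a - c)‖ ≤ η * ‖a - c‖ := by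
  have hc := (hf.continuousOn_fderivWithin hu le_rfl) q hq
  obtain ⟨δ, hδ, h⟩ := Metric.continuousWithinAt_iff.1 hc η hη
  refine ⟨δ, hδ, fun a ha c hc' hda hdc => ?_⟩
  refine Convex.norm_image_sub_le_of_norm_hasFDerivWithin_le' (s := D ∩ Metric.ball q δ)
    (f' := fderivWithin ℝ f D) ?_ ?_ (hD.inter (convex_ball q δ)) ⟨hc', hdc⟩ ⟨ha, hda⟩
  · intro x hx
    exact ((hf.differentiableOn one_ne_zero x hx.1).hasFDerivWithinAt).mono inter_subset_left
  · intro x hx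
    rw [← dist_eq_norm]
    exact (h hx.1 hx.2).le

lemma uniqueDiffOn_Ioo_inter_Ico {Te t₀ ε : ℝ} (ht₀ : t₀ ∈ Ico 0 Te) (hε : 0 < ε) :
    UniqueDiffOn ℝ (Ioo (t₀ - ε) (t₀ + ε) ∩ Ico 0 Te) := by
  refine uniqueDiffOn_convex ((convex_Ioo _ _).inter (convex_Ico _ _)) ?_
  obtain ⟨r, hr1, hr2⟩ := exists_between (lt_min (lt_add_of_pos_right t₀ hε) ht₀.2)
  refine ⟨r, mem_interior.2 ⟨Ioo t₀ (min (t₀ + ε) Te), ?_, isOpen_Ioo, hr1, hr2⟩⟩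
  intro u hu
  have := lt_min_iff.1 hu.2
  exact ⟨⟨by linarith [hu.1], this.1⟩, ht₀.1.trans hu.1.le, this.2⟩

/-- Points near `γ (0, t₀)` on the curves `γ (·, t)` have parameters near `0`. -/
lemma exists_small_parameter {ε σ t₀ : ℝ} {J : Set ℝ} {γ : ℝ × ℝ → E3} (ht₀ : t₀ ∈ J)
    (hγ : ContinuousOn γ (Icc (-ε) ε ×ˢ J)) (hε : 0 < ε)
    (hinj : InjOn (fun s => γ (s, t₀)) (Icc (-ε) ε)) (hσ : 0 < σ) :
    ∃ ρ : ℝ, 0 < ρ ∧ ∀ t ∈ J, |t - t₀| < ρ → ∀ s ∈ Icc (-ε) ε, dist (γ (s, t)) (γ (0, t₀)) < ρ →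
      |s| ≤ σ := by
  have hK : IsCompact (Icc (-ε) ε ∩ {s : ℝ | σ ≤ |s|}) :=
    isCompact_Icc.inter_right (isClosed_le continuous_const continuous_abs)
  -- Injectivity at time `t₀` keeps the parameters `σ ≤ |s|` away from `γ (0, t₀)`; compactness of
  -- this parameter set makes the separation uniform for nearby times and points.
  have key := hK.eventually_forall_of_forall_eventually (x₀ := ((t₀, γ (0, t₀)) : ℝ × E3))
    (P := fun z s => s ∈ Icc (-ε) ε → z.1 ∈ J → γ (s, z.1) ≠ z.2) (by
      intro s hs
      have hne : γ (s, t₀) ≠ γ (0, t₀) := by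
        intro h
        have h0 : s = 0 := hinj hs.1 ⟨by linarith, hε.le⟩ h
        have := hs.2
        simp only [mem_ofPred_eq, h0, abs_zero] at this
        linarith
      have hc := hγ (s, t₀) ⟨hs.1, ht₀⟩
      obtain ⟨A, B, hA, hB, hsA, hB0, hAB⟩ := t2_separation hne
      have h1 := hc (hA.mem_nhds hsA)
      rw [mem_map, mem_nhdsWithin_iff_eventually] at h1
      have h2 : ∀ᶠ z : (ℝ × E3) × ℝ in 𝓝 ((t₀, γ (0, t₀)), s),
          (z.2, z.1.1) ∈ Icc (-ε) ε ×ˢ J → (z.2, z.1.1) ∈ γ ⁻¹' A :=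
        (Continuous.tendsto' (by fun_prop) _ _ rfl :
          Tendsto (fun z : (ℝ × E3) × ℝ => (z.2, z.1.1)) (𝓝 ((t₀, γ (0, t₀)), s))
            (𝓝 (s, t₀))).eventually h1
      have h3 : ∀ᶠ z : (ℝ × E3) × ℝ in 𝓝 ((t₀, γ (0, t₀)), s), z.1.2 ∈ B :=
        (Continuous.tendsto' (by fun_prop) _ _ rfl :
          Tendsto (fun z : (ℝ × E3) × ℝ => z.1.2) (𝓝 ((t₀, γ (0, t₀)), s))
            (𝓝 (γ (0, t₀)))).eventually (hB.mem_nhds hB0)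
      filter_upwards [h2, h3] with z hz2 hz3 hs' hJ heq
      exact disjoint_left.1 hAB (hz2 ⟨hs', hJ⟩) (by rw [heq]; exact hz3))
  obtain ⟨ρ, hρ, h⟩ := Metric.eventually_nhds_iff.1 key
  refine ⟨ρ, hρ, fun t ht htρ s hs hd => ?_⟩
  by_contra! hlt
  refine h (y := (t, γ (s, t))) ?_ s ⟨hs, hlt.le⟩ hs ht rfl
  rw [Prod.dist_eq]
  exact max_lt (by rwa [Real.dist_eq]) hd

lemma abs_clamp_sub_clamp_le (σ s s' : ℝ) :
    |max (-σ) (min s σ) - max (-σ) (min s' σ)| ≤ |s - s'| := by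
  refine (abs_max_sub_max_le_max _ _ _ _).trans ?_
  rw [sub_self, abs_zero, max_eq_right (abs_nonneg _)]
  refine (abs_min_sub_min_le_max _ _ _ _).trans ?_
  rw [sub_self, abs_zero, max_eq_left (abs_nonneg _)]

/-- Two unit vectors are close if multiples of them are close. -/
lemma norm_sub_le_of_norm_smul_sub_smul_le {u v : E3} (hu : ‖u‖ = 1) (hv : ‖v‖ = 1) {c d η : ℝ}
    (hc : 0 < c) (hd : 0 < d) (h : ‖c • u - d • v‖ ≤ η) : d * ‖u - v‖ ≤ 2 * η := by
  have h1 : |c - d| ≤ η := by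
    have := abs_norm_sub_norm_le (c • u) (d • v)
    rw [norm_smul, norm_smul, hu, hv, mul_one, mul_one, Real.norm_of_nonneg hc.le,
      Real.norm_of_nonneg hd.le] at this
    exact this.trans h
  have h2 : d • (u - v) = (c • u - d • v) - (c - d) • u := by module
  calc d * ‖u - v‖ = ‖d • (u - v)‖ := by rw [norm_smul, Real.norm_of_nonneg hd.le]
    _ ≤ ‖c • u - d • v‖ + ‖(c - d) • u‖ := by rw [h2]; exact norm_sub_le _ _
    _ ≤ 2 * η := by rw [norm_smul, hu, mul_one, Real.norm_eq_abs]; linarith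

/-- The map `r ↦ f r - r • p` is `η`-Lipschitz near `s`, which bounds its derivative. -/
lemma norm_deriv_sub_le_of_strict_estimate {f : ℝ → E3} {f' p : E3} {s η σ : ℝ} (hη : 0 ≤ η)
    (hs : |s| < σ) (hf : HasDerivAt f f' s)
    (h : ∀ r r', |r| < σ → |r'| < σ → ‖f r - f r' - (r - r') • p‖ ≤ η * |r - r'|) :
    ‖f' - p‖ ≤ η := by
  have hd : HasDerivAt (fun r => f r - r • p) (f' - p) s := by
    have := hf.sub ((hasDerivAt_id s).smul_const p)
    rw [one_smul] at this
    exact this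
  refine hd.le_of_lip' hη ?_
  have : ∀ᶠ r in 𝓝 s, |r| < σ := (continuous_abs.tendsto s).eventually_lt_const hs
  filter_upwards [this] with r hr
  have := h r s hr hs
  rw [Real.norm_eq_abs]
  refine le_of_eq_of_le (congrArg norm ?_) this
  module

/-- A point of the extended curve `g` near `x₀` has a small parameter. -/
lemma abs_parameter_le {g : ℝ → E3} {p x₀ : E3} {η s r a : ℝ} (hη : η ≤ ‖p‖ / 2)
    (hg : ∀ s s', ‖g s - g s' - (s - s') • p‖ ≤ η * |s - s'|)
    (h0 : ‖g 0 - x₀‖ ≤ a) (hs : ‖g s - x₀‖ ≤ r) : |s| * (‖p‖ / 2) ≤ r + a := by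
  have h1 := hg s 0
  rw [sub_zero] at h1
  have h2 : ‖s • p‖ ≤ ‖g s - g 0 - s • p‖ + ‖g s - x₀‖ + ‖g 0 - x₀‖ := by
    calc ‖s • p‖ = ‖-(g s - g 0 - s • p) + (g s - x₀) - (g 0 - x₀)‖ := by congr 1; module
      _ ≤ _ := (norm_sub_le _ _).trans (by
        gcongr; exact (norm_add_le _ _).trans (by rw [norm_neg]))
  rw [norm_smul, Real.norm_eq_abs] at h2
  nlinarith [abs_nonneg s]

/-- Strict differentiability of the chart, relative to a convex set that may be one-sided in time,
controls chords in `s` at all nearby times at once. Here `p` and `V` are the two partial derivatives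
of the chart at `(0, t₀)`. -/
lemma IsMovingCurve.exists_hasFirstOrderModel {Ω : Set E3} {Te : ℝ} {ℓ : ℝ → Set E3}
    {τ : ℝ → E3 → E3} (h : IsMovingCurve Ω Te ℓ τ) {t₀ : ℝ} (ht₀ : t₀ ∈ Ico 0 Te) {x₀ : E3}
    (hx₀ : x₀ ∈ ℓ t₀) :
    ∃ c : ℝ, 0 < c ∧ ∃ V : E3, HasFirstOrderModel Te ℓ τ t₀ x₀ (c • τ t₀ x₀) V := by
  obtain ⟨U, hU, ε, hε, γ, hγ0, hγ, hprop⟩ := h.chart t₀ ht₀ x₀ hx₀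
  set J := Ioo (t₀ - ε) (t₀ + ε) ∩ Ico 0 Te with hJ
  have ht₀J : t₀ ∈ J := ⟨⟨by linarith, by linarith⟩, ht₀⟩
  have h0ε : (0 : ℝ) ∈ Icc (-ε) ε := ⟨by linarith, hε.le⟩
  set D := Icc (-ε) ε ×ˢ J with hD
  have hq : ((0, t₀) : ℝ × ℝ) ∈ D := ⟨h0ε, ht₀J⟩
  have hconv : Convex ℝ D := (convex_Icc _ _).prod ((convex_Ioo _ _).inter (convex_Ico _ _))
  have huniq : UniqueDiffOn ℝ D :=
    (uniqueDiffOn_Icc (by linarith)).prod (uniqueDiffOn_Ioo_inter_Ico ht₀ hε)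
  have hstrict := fun η (hη : 0 < η) => exists_strict_estimate_of_contDiffOn hγ hconv huniq hq hη
  set L := fderivWithin ℝ γ D (0, t₀) with hL
  have hslice : ∀ η : ℝ, 0 < η → ∃ σ : ℝ, 0 < σ ∧ σ < ε ∧ (∀ t ∈ J, |t - t₀| < σ → ∀ s s', |s| ≤ σ → |s'| ≤ σ →
      ‖γ (s, t) - γ (s', t) - (s - s') • L (1, 0)‖ ≤ η * |s - s'|) ∧
      ∀ t ∈ J, |t - t₀| < σ → ‖γ (0, t) - x₀ - (t - t₀) • L (0, 1)‖ ≤ η * |t - t₀| := by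
    intro η hη
    obtain ⟨δ, hδ, hest⟩ := hstrict η hη
    have hσ1 : min (δ / 2) (ε / 2) ≤ δ / 2 := min_le_left _ _
    have hσ2 : min (δ / 2) (ε / 2) ≤ ε / 2 := min_le_right _ _
    refine ⟨min (δ / 2) (ε / 2), by positivity, by linarith, ?_, ?_⟩
    · intro t ht htσ s s' hs hs'
      have hmem : ∀ s, |s| ≤ min (δ / 2) (ε / 2) → ((s, t) : ℝ × ℝ) ∈ D ∧
          dist ((s, t) : ℝ × ℝ) (0, t₀) < δ := by
        intro s hs
        refine ⟨⟨abs_le.1 (by linarith), ht⟩, ?_⟩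
        rw [Prod.dist_eq, Real.dist_eq, Real.dist_eq, sub_zero]
        exact max_lt (by linarith) (by linarith)
      have := hest _ (hmem s hs).1 _ (hmem s' hs').1 (hmem s hs).2 (hmem s' hs').2
      have e : ((s, t) : ℝ × ℝ) - (s', t) = (s - s') • (1, 0) := by simp
      rw [e, map_smul, norm_smul, Real.norm_eq_abs] at this
      simpa using this
    · intro t ht htσ
      have := hest (0, t) ⟨h0ε, ht⟩ (0, t₀) hq (by
        rw [Prod.dist_eq, Real.dist_eq, Real.dist_eq, sub_zero, abs_zero]
        exact max_lt hδ (by linarith)) (by simpa using hδ)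
      have e : ((0, t) : ℝ × ℝ) - (0, t₀) = (t - t₀) • (0, 1) := by simp
      rw [e, map_smul, norm_smul, Real.norm_eq_abs, hγ0] at this
      simpa using this
  have hderiv : ∀ η : ℝ, 0 < η → ∃ σ : ℝ, 0 < σ ∧ σ < ε ∧ ∀ t ∈ J, |t - t₀| < σ → ∀ s, |s| < σ →
      ∃ c : ℝ, 0 < c ∧ ‖c • τ t (γ (s, t)) - L (1, 0)‖ ≤ η := by
    intro η hη
    obtain ⟨σ, hσ, hσε, hs1, -⟩ := hslice η hη
    refine ⟨σ, hσ, hσε, fun t ht htσ s hs => ?_⟩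
    obtain ⟨c, hc, hd⟩ := (hprop t ht).2.2.1 s (abs_lt.1 (hs.trans hσε))
    exact ⟨c, hc, norm_deriv_sub_le_of_strict_estimate hη.le hs hd
      fun r r' hr hr' => hs1 t ht htσ r r' hr.le hr'.le⟩
  obtain ⟨c, hc, hd⟩ := (hprop t₀ ht₀J).2.2.1 0 ⟨by linarith, hε⟩
  have hp : c • τ t₀ x₀ = L (1, 0) := by
    rw [hγ0] at hd
    rw [← sub_eq_zero, ← norm_le_zero_iff]
    refine le_of_forall_pos_le_add fun η hη => ?_
    obtain ⟨σ, hσ, hσε, hs1, -⟩ := hslice η hη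
    rw [zero_add]
    exact norm_deriv_sub_le_of_strict_estimate hη.le (by simpa using hσ) hd
      fun r r' hr hr' => hs1 t₀ ht₀J (by simpa using hσ) r r' hr.le hr'.le
  refine ⟨c, hc, L (0, 1), fun η' hη' => ?_⟩
  have hnp : ‖c • τ t₀ x₀‖ = c := by
    rw [norm_smul, h.unit t₀ ht₀ x₀ hx₀, mul_one, Real.norm_of_nonneg hc.le]
  set V := L (0, 1)
  rw [← hp] at hslice hderiv
  set p := c • τ t₀ x₀ with hpdef
  -- `η ≤ c / 2` lets the curve be inverted near `x₀`; `η ≤ η' * c / 2` turns closeness of `d • τ`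
  -- to `p = c • τ t₀ x₀` into closeness of the unit tangents.
  obtain ⟨η, hη, hηη', hηc, hητ⟩ : ∃ η > 0, η ≤ η' ∧ η ≤ c / 2 ∧ η ≤ η' * c / 2 :=
    ⟨min η' (min (c / 2) (η' * c / 2)), by positivity, min_le_left _ _,
      (min_le_right _ _).trans (min_le_left _ _), (min_le_right _ _).trans (min_le_right _ _)⟩
  obtain ⟨σ₁, hσ₁, hσ₁ε, hs1, hs2⟩ := hslice η hη
  obtain ⟨σ₂, hσ₂, hσ₂ε, hs3⟩ := hderiv η hη
  obtain ⟨σ, hσ, hσσ₁, hσσ₂⟩ : ∃ σ > 0, σ ≤ σ₁ ∧ σ < σ₂ :=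
    ⟨min σ₁ (σ₂ / 2), by positivity, min_le_left _ _, (min_le_right _ _).trans_lt (by linarith)⟩
  obtain ⟨ρ, hρ, hloc⟩ := exists_small_parameter ht₀J hγ.continuousOn hε (hprop t₀ ht₀J).1 hσ
  obtain ⟨ρ', hρ', hρU⟩ := Metric.mem_nhds_iff.1 hU
  -- The last bound makes every parameter of a point of `g` in the `δ`-ball at most `σ`, since `|s|
  -- c / 2 ≤ δ (1 + η + ‖V‖)`.
  obtain ⟨δ, hδ, h1, h2, h3, h4, h5, h6⟩ : ∃ δ > 0, δ ≤ σ₁ ∧ δ ≤ σ₂ ∧ δ ≤ ρ ∧ δ ≤ ρ' ∧ δ ≤ ε ∧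
      δ ≤ σ * c / (2 * (1 + η + ‖V‖)) :=
    ⟨min σ₁ (min σ₂ (min ρ (min ρ' (min ε (σ * c / (2 * (1 + η + ‖V‖))))))), by positivity,
      by simp, by simp, by simp, by simp, by simp, by simp⟩
  refine ⟨δ, hδ, fun t ht htδ => ?_⟩
  have htJ : t ∈ J := ⟨⟨by linarith [(abs_lt.1 htδ).1], by linarith [(abs_lt.1 htδ).2]⟩, ht⟩
  have hcl : ∀ s : ℝ, |max (-σ) (min s σ)| ≤ σ := fun s =>
    abs_le.2 ⟨le_max_left _ _, max_le (by linarith) (min_le_right _ _)⟩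
  have hcl' : ∀ s : ℝ, |s| ≤ σ → max (-σ) (min s σ) = s := fun s hs => by
    rw [min_eq_left (abs_le.1 hs).2, max_eq_right (abs_le.1 hs).1]
  -- Beyond `|s| ≤ σ` the curve is continued by straight rays of direction `p`. Then `g s - s • p`
  -- depends only on the clamped parameter, and clamping is 1-Lipschitz, so the chord estimate
  -- becomes global.
  obtain ⟨g, hg⟩ : ∃ g : ℝ → E3, g = fun s => γ (max (-σ) (min s σ), t) +
    (s - max (-σ) (min s σ)) • p := ⟨_, rfl⟩
  have hgs : ∀ s, |s| ≤ σ → g s = γ (s, t) := fun s hs => by simp [hg, hcl' s hs]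
  have hgest : ∀ s s', ‖g s - g s' - (s - s') • p‖ ≤ η * |s - s'| := by
    intro s s'
    have := hs1 t htJ (by linarith) (max (-σ) (min s σ)) (max (-σ) (min s' σ))
      ((hcl s).trans hσσ₁) ((hcl s').trans hσσ₁)
    refine le_trans (le_of_eq ?_) (this.trans
      (mul_le_mul_of_nonneg_left (abs_clamp_sub_clamp_le σ s s') hη.le))
    rw [hg]
    congr 1
    module
  have hg0 : g 0 = γ (0, t) := hgs 0 (by simpa using hσ.le)
  have hg0est : ‖g 0 - x₀ - (t - t₀) • V‖ ≤ η * |t - t₀| := by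
    rw [hg0]; exact hs2 t htJ (by linarith)
  have hg0' : ‖g 0 - x₀‖ ≤ (η + ‖V‖) * δ := by
    calc ‖g 0 - x₀‖ ≤ ‖g 0 - x₀ - (t - t₀) • V‖ + ‖(t - t₀) • V‖ := norm_le_norm_sub_add _ _
      _ ≤ η * |t - t₀| + |t - t₀| * ‖V‖ := by
        rw [norm_smul, Real.norm_eq_abs]; linarith
      _ = (η + ‖V‖) * |t - t₀| := by ring
      _ ≤ _ := by gcongr
  have hpar : ∀ y ∈ Metric.ball x₀ δ, y ∈ ℓ t → ∃ s, |s| ≤ σ ∧ γ (s, t) = y := by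
    intro y hy hyt
    obtain ⟨s, hs, hsy⟩ := (hprop t htJ).2.2.2 ⟨hyt, hρU (Metric.ball_subset_ball h4 hy)⟩
    refine ⟨s, hloc t htJ (htδ.trans_le h3) s hs ?_, hsy⟩
    rw [hγ0]
    have : γ (s, t) = y := hsy
    rw [this]
    exact lt_of_lt_of_le hy h3
  refine ⟨g, fun s s' => (hgest s s').trans (by gcongr), hg0est.trans (by gcongr),
    fun y hy => ⟨⟨fun hyt => ?_, ?_⟩, fun hyt => ?_⟩⟩
  · obtain ⟨s, hs, rfl⟩ := hpar y hy hyt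
    exact ⟨s, hgs s hs⟩
  · rintro ⟨s, rfl⟩
    have hs : |s| * (‖p‖ / 2) ≤ δ + (η + ‖V‖) * δ :=
      abs_parameter_le (by rw [hnp]; exact hηc) hgest hg0' (by
        rw [← dist_eq_norm]; exact (Metric.mem_ball.1 hy).le)
    rw [hnp] at hs
    have hpos : 0 < 2 * (1 + η + ‖V‖) := by positivity
    rw [le_div_iff₀ hpos] at h6
    have hsσ : |s| ≤ σ := by
      by_contra! hlt
      nlinarith
    rw [hgs s hsσ]
    exact (hprop t htJ).2.1 s (abs_le.1 (by linarith))
  · obtain ⟨s, hs, rfl⟩ := hpar y hy hyt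
    obtain ⟨d, hd, hdn⟩ := hs3 t htJ (by linarith) s (by linarith)
    have := norm_sub_le_of_norm_smul_sub_smul_le (h.unit t ht _ hyt) (h.unit t₀ ht₀ x₀ hx₀) hd hc hdn
    nlinarith

/-! ### Crossing of the normal plane and the normal velocity -/

lemma abs_inner_sub_mul_le {g : ℝ → E3} {u x₀ : E3} {c η : ℝ} (hu : ‖u‖ = 1)
    (hg : ∀ s s', ‖g s - g s' - (s - s') • c • u‖ ≤ η * |s - s'|) (s s' : ℝ) :
    |inner ℝ (g s - x₀) u - inner ℝ (g s' - x₀) u - (s - s') * c| ≤ η * |s - s'| := by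
  have h1 : inner ℝ (g s - g s' - (s - s') • c • u) u =
      inner ℝ (g s - x₀) u - inner ℝ (g s' - x₀) u - (s - s') * c := by
    simp only [inner_sub_left, inner_smul_left, real_inner_self_eq_norm_sq, hu]
    simp
  rw [← h1]
  refine (abs_real_inner_le_norm _ _).trans ?_
  rw [hu, mul_one]
  exact hg s s'

/-- A curve that is close to a line crosses each plane orthogonal to the line exactly once. -/
lemma existsUnique_inner_eq_zero {g : ℝ → E3} {u x₀ : E3} {c η : ℝ} (hu : ‖u‖ = 1) (hc : 0 < c)
    (hη : η ≤ c / 2) (hg : ∀ s s', ‖g s - g s' - (s - s') • c • u‖ ≤ η * |s - s'|) :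
    ∃! s, inner ℝ (g s - x₀) u = 0 := by
  obtain ⟨f, hf⟩ : ∃ f : ℝ → ℝ, f = fun s => inner ℝ (g s - x₀) u := ⟨_, rfl⟩
  have hest : ∀ s s', |f s - f s' - (s - s') * c| ≤ η * |s - s'| := by
    intro s s'; rw [hf]; exact abs_inner_sub_mul_le hu hg s s'
  -- The height over the plane grows with slope at least `c / 2`; hence it has at most one zero, and
  -- one within `|s| ≤ 2 |f 0| / c`.
  have hgrow : ∀ s s', s ≤ s' → f s + c / 2 * (s' - s) ≤ f s' := by
    intro s s' hs
    have := (abs_le.1 (hest s' s)).1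
    rw [abs_of_nonneg (sub_nonneg.2 hs)] at this
    nlinarith
  have hcont : Continuous f := by
    have : LipschitzWith (Real.toNNReal (c + c / 2)) f := by
      refine LipschitzWith.of_dist_le_mul fun s s' => ?_
      rw [Real.dist_eq, Real.dist_eq, Real.coe_toNNReal _ (by linarith)]
      calc |f s - f s'| = |(f s - f s' - (s - s') * c) + (s - s') * c| := by ring_nf
        _ ≤ η * |s - s'| + |s - s'| * c := by
          refine (abs_add_le _ _).trans ?_
          rw [abs_mul, abs_of_pos hc]
          linarith [hest s s']
        _ ≤ _ := by nlinarith [abs_nonneg (s - s')]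
    exact this.continuous
  have hS : 0 ≤ 2 * |f 0| / c := by positivity
  have hSc : c / 2 * (2 * |f 0| / c) = |f 0| := by field_simp
  obtain ⟨s, -, hs⟩ := intermediate_value_Icc (by linarith : -(2 * |f 0| / c) ≤ 2 * |f 0| / c)
    hcont.continuousOn (show (0 : ℝ) ∈ Icc (f (-(2 * |f 0| / c))) (f (2 * |f 0| / c)) by
      have h1 := hgrow 0 _ hS
      have h2 := hgrow (-(2 * |f 0| / c)) 0 (by linarith)
      rw [sub_zero, hSc] at h1
      rw [zero_sub, neg_neg, hSc] at h2
      exact ⟨by linarith [le_abs_self (f 0)], by linarith [neg_abs_le (f 0)]⟩)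
  rw [hf] at hs
  refine ⟨s, hs, fun s' hs' => ?_⟩
  have hs1 : f s = 0 := by rw [hf]; exact hs
  have hs2 : f s' = 0 := by rw [hf]; exact hs'
  rcases le_total s s' with h | h
  · have := hgrow s s' h
    nlinarith
  · have := hgrow s' s h
    nlinarith

/-- The crossing parameter solves `s c + (t - t₀) V · u + e · u = 0` with `‖e‖ ≤ η (|s| + |t -
t₀|)`, so `s = O(|t - t₀|)`. Eliminating `s` leaves the displacement `(t - t₀) v` plus the part of
`e` orthogonal to `u`. -/
lemma HasFirstOrderModel.crossing {Te : ℝ} {ℓ : ℝ → Set E3} {τ : ℝ → E3 → E3} {t₀ : ℝ}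
    {x₀ V : E3} {c : ℝ} (hc : 0 < c) (hu : ‖τ t₀ x₀‖ = 1)
    (h : HasFirstOrderModel Te ℓ τ t₀ x₀ (c • τ t₀ x₀) V) {v : E3}
    (hv : v = V - (inner ℝ V (τ t₀ x₀) : ℝ) • τ t₀ x₀) {κ : ℝ} (hκ : 0 < κ) :
    ∃ δ : ℝ, 0 < δ ∧ ∃ δ' : ℝ, 0 < δ' ∧ ∀ t ∈ Ico 0 Te, |t - t₀| < δ' → ∃ y,
      ℓ t ∩ normalPlane x₀ (τ t₀ x₀) ∩ Metric.ball x₀ δ = {y} ∧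
      ‖y - x₀ - (t - t₀) • v‖ ≤ κ * |t - t₀| := by
  -- `C` results from absorbing `c / 2 * |s|` into the left side of `c |s| ≤ |t - t₀| ‖V‖ + c / 2 *
  -- (|s| + |t - t₀|)`.
  obtain ⟨C, hC⟩ : ∃ C : ℝ, C = (2 * ‖V‖ + c) / c := ⟨_, rfl⟩
  have hC0 : 0 < C := by rw [hC]; positivity
  have hCc : c * C = 2 * ‖V‖ + c := by rw [hC]; field_simp
  obtain ⟨η, hη, hηc, hηκ⟩ : ∃ η : ℝ, 0 < η ∧ η ≤ c / 2 ∧ η ≤ κ / (2 * (C + 1)) :=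
    ⟨min (c / 2) (κ / (2 * (C + 1))), by positivity, min_le_left _ _, min_le_right _ _⟩
  obtain ⟨δ, hδ, hmod⟩ := h η hη
  refine ⟨δ, hδ, min δ (δ / (κ + ‖v‖)), by positivity, fun t ht htδ => ?_⟩
  obtain ⟨g, hg, hg0, hgr⟩ := hmod t ht (htδ.trans_le (min_le_left _ _))
  obtain ⟨s, hs, hsu⟩ := existsUnique_inner_eq_zero (x₀ := x₀) hu hc hηc hg
  simp only at hs hsu
  set u := τ t₀ x₀ with hudef
  obtain ⟨e, he⟩ : ∃ e : E3, e = g s - x₀ - s • c • u - (t - t₀) • V := ⟨_, rfl⟩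
  have hen : ‖e‖ ≤ η * (|s| + |t - t₀|) := by
    have h1 := hg s 0
    rw [sub_zero] at h1
    calc ‖e‖ = ‖(g s - g 0 - s • c • u) + (g 0 - x₀ - (t - t₀) • V)‖ := by
          rw [he]; congr 1; module
      _ ≤ _ := (norm_add_le _ _).trans (by linarith)
  have hin : s * c + (t - t₀) * inner ℝ V u + inner ℝ e u = 0 := by
    have : g s - x₀ = s • c • u + (t - t₀) • V + e := by rw [he]; module
    rw [this] at hs
    simp only [inner_add_left, inner_smul_left, real_inner_self_eq_norm_sq, hu] at hs
    simp at hs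
    linarith
  have hVu := (abs_real_inner_le_norm V u)
  have heu := (abs_real_inner_le_norm e u)
  rw [hu, mul_one] at hVu heu
  have hsC : |s| ≤ C * |t - t₀| := by
    have h1 : |s| * c ≤ |t - t₀| * ‖V‖ + ‖e‖ := by
      have : s * c = -((t - t₀) * inner ℝ V u) - inner ℝ e u := by linarith
      calc |s| * c = |s * c| := by rw [abs_mul, abs_of_pos hc]
        _ ≤ |t - t₀| * |inner ℝ V u| + |inner ℝ e u| := by
          rw [this, ← abs_mul, ← abs_neg ((t - t₀) * inner ℝ V u)]; exact abs_sub _ _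
        _ ≤ _ := by gcongr
    have h2 : ‖e‖ ≤ c / 2 * (|s| + |t - t₀|) := hen.trans (by gcongr)
    have h3 : c * |s| ≤ c * (C * |t - t₀|) := by
      rw [← mul_assoc, hCc]; linarith
    exact le_of_mul_le_mul_left h3 hc
  have hest : ‖g s - x₀ - (t - t₀) • v‖ ≤ κ * |t - t₀| := by
    have : g s - x₀ - (t - t₀) • v = e - (inner ℝ e u : ℝ) • u := by
      have h1 : (inner ℝ e u : ℝ) = -(s * c) - (t - t₀) * inner ℝ V u := by linarith
      rw [h1, hv, he]; module
    rw [this]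
    calc ‖e - (inner ℝ e u : ℝ) • u‖ ≤ ‖e‖ + |inner ℝ e u| := by
          refine (norm_sub_le _ _).trans ?_
          rw [norm_smul, hu, mul_one, Real.norm_eq_abs]
      _ ≤ 2 * (η * (C * |t - t₀| + |t - t₀|)) := by
        have : ‖e‖ ≤ η * (C * |t - t₀| + |t - t₀|) := hen.trans (by gcongr)
        linarith
      _ = η * (2 * (C + 1)) * |t - t₀| := by ring
      _ ≤ κ * |t - t₀| := by
        gcongr
        exact (le_div_iff₀ (by positivity)).1 hηκ
  have hball : g s ∈ Metric.ball x₀ δ := by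
    rw [mem_ball_iff_norm]
    have h1 : ‖g s - x₀‖ ≤ (κ + ‖v‖) * |t - t₀| := by
      refine (norm_le_norm_sub_add _ ((t - t₀) • v)).trans ?_
      rw [norm_smul, Real.norm_eq_abs]; linarith
    have h2 := htδ.trans_le (min_le_right _ _)
    rw [lt_div_iff₀ (by positivity)] at h2
    linarith
  refine ⟨g s, ?_, hest⟩
  ext y
  simp only [mem_singleton_iff]
  constructor
  · rintro ⟨⟨hy1, hy2⟩, hy3⟩
    obtain ⟨r, rfl⟩ := (hgr y hy3).1.1 hy1
    rw [hsu r hy2]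
  · rintro rfl
    exact ⟨⟨(hgr _ hball).1.2 ⟨s, rfl⟩, hs⟩, hball⟩

lemma eventually_nhdsWithin_of_forall_abs_sub_lt {S : Set ℝ} {t₀ δ : ℝ} (hδ : 0 < δ)
    {P : ℝ → Prop} (h : ∀ t ∈ S, |t - t₀| < δ → P t) : ∀ᶠ t in 𝓝[S] t₀, P t := by
  rw [eventually_nhdsWithin_iff]
  filter_upwards [Metric.ball_mem_nhds t₀ hδ] with t ht hS
  exact h t hS (by rwa [← Real.dist_eq])

theorem HasFirstOrderModel.hasNormalVelocity {Te : ℝ} {ℓ : ℝ → Set E3} {τ : ℝ → E3 → E3} {t₀ : ℝ}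
    {x₀ V : E3} {c : ℝ} (hc : 0 < c) (ht₀ : t₀ ∈ Ico 0 Te) (hu : ‖τ t₀ x₀‖ = 1)
    (h : HasFirstOrderModel Te ℓ τ t₀ x₀ (c • τ t₀ x₀) V) :
    HasNormalVelocity Te ℓ τ t₀ x₀ (V - (inner ℝ V (τ t₀ x₀) : ℝ) • τ t₀ x₀) := by
  set v := V - (inner ℝ V (τ t₀ x₀) : ℝ) • τ t₀ x₀ with hv
  obtain ⟨δ, hδ, δ', hδ', H⟩ := h.crossing hc hu hv one_pos
  have Hex : ∀ t, ∃ y, t ∈ Ico 0 Te → |t - t₀| < δ' →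
      ℓ t ∩ normalPlane x₀ (τ t₀ x₀) ∩ Metric.ball x₀ δ = {y} ∧
      ‖y - x₀ - (t - t₀) • v‖ ≤ 1 * |t - t₀| := by
    intro t
    by_cases ht : t ∈ Ico 0 Te ∧ |t - t₀| < δ'
    · obtain ⟨y, hy⟩ := H t ht.1 ht.2
      exact ⟨y, fun _ _ => hy⟩
    · exact ⟨x₀, fun h1 h2 => (ht ⟨h1, h2⟩).elim⟩
  choose ξ hξ using Hex
  have h0 : ξ t₀ = x₀ := by
    have := (hξ t₀ ht₀ (by simpa using hδ')).2
    simpa [sub_eq_zero] using this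
  refine ⟨Metric.ball x₀ δ, Metric.ball_mem_nhds _ hδ, ξ, h0,
    eventually_nhdsWithin_of_forall_abs_sub_lt hδ' fun t ht htd => (hξ t ht htd).1, ?_⟩
  rw [hasDerivWithinAt_iff_isLittleO, Asymptotics.isLittleO_iff]
  intro κ hκ
  -- The ball of the crossing lemma depends on `κ`, whereas `ξ` was built in the ball for `κ = 1`.
  -- For `t` close to `t₀` the new crossing point also lies in the old ball, hence equals `ξ t`.
  obtain ⟨δ₂, hδ₂, δ₂', hδ₂', H₂⟩ := h.crossing hc hu hv hκ
  refine eventually_nhdsWithin_of_forall_abs_sub_lt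
    (δ := min (min δ' δ₂') (δ / (κ + ‖v‖))) (by positivity) fun t ht htd => ?_
  have htd1 := htd.trans_le ((min_le_left _ _).trans (min_le_left _ _))
  have htd2 := htd.trans_le ((min_le_left _ _).trans (min_le_right _ _))
  obtain ⟨y, hy, hyest⟩ := H₂ t ht htd2
  have hyball : y ∈ Metric.ball x₀ δ := by
    rw [mem_ball_iff_norm]
    have h1 : ‖y - x₀‖ ≤ (κ + ‖v‖) * |t - t₀| := by
      refine (norm_le_norm_sub_add _ ((t - t₀) • v)).trans ?_
      rw [norm_smul, Real.norm_eq_abs]; linarith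
    have h2 := htd.trans_le (min_le_right _ _)
    rw [lt_div_iff₀ (by positivity)] at h2
    linarith
  have hyξ : y = ξ t := by
    have h1 : y ∈ ℓ t ∩ normalPlane x₀ (τ t₀ x₀) ∩ Metric.ball x₀ δ₂ := by rw [hy]; rfl
    have h2 : y ∈ ℓ t ∩ normalPlane x₀ (τ t₀ x₀) ∩ Metric.ball x₀ δ := ⟨h1.1, hyball⟩
    rw [(hξ t ht htd1).1] at h2
    exact h2
  rw [h0, ← hyξ, Real.norm_eq_abs]
  exact hyest

/-- Continuity carries `ζ` into the neighbourhood belonging to `ξ`, so the two crossing paths agree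
near `t₀`; derivatives within `[0, Te)` are unique, also at `0`. -/
theorem HasNormalVelocity.unique {Te : ℝ} {ℓ : ℝ → Set E3} {τ : ℝ → E3 → E3} {t₀ : ℝ}
    {x₀ v w : E3} (ht₀ : t₀ ∈ Ico 0 Te) (hv : HasNormalVelocity Te ℓ τ t₀ x₀ v)
    (hw : HasNormalVelocity Te ℓ τ t₀ x₀ w) : v = w := by
  obtain ⟨U, hU, ξ, hξ0, hξ, hξd⟩ := hv
  obtain ⟨W, hW, ζ, hζ0, hζ, hζd⟩ := hw
  have hc : Tendsto ζ (𝓝[Ico 0 Te] t₀) (𝓝 x₀) := by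
    have := hζd.continuousWithinAt.tendsto
    rwa [hζ0] at this
  have heq : ζ =ᶠ[𝓝[Ico 0 Te] t₀] ξ := by
    filter_upwards [hξ, hζ, hc hU] with t h1 h2 h3
    have h4 : ζ t ∈ ℓ t ∩ normalPlane x₀ (τ t₀ x₀) ∩ W := by rw [h2]; rfl
    have h5 : ζ t ∈ ℓ t ∩ normalPlane x₀ (τ t₀ x₀) ∩ U := ⟨h4.1, h3⟩
    rw [h1] at h5
    exact h5
  have hξd' := hξd.congr_of_eventuallyEq heq (by rw [hζ0, hξ0])
  exact UniqueDiffWithinAt.eq_deriv _ (uniqueDiffOn_Ico 0 Te t₀ ht₀) hξd' hζd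

/-! ### Line integrals along nearly straight curves -/

lemma abs_integral_sub_le_of_nonneg {X : Type*} [MeasurableSpace X] {μ ν : Measure X} {m η : ℝ}
    (hη : 0 ≤ η) (hm : η ≤ m) (h1 : ENNReal.ofReal (m - η) • μ ≤ ν)
    (h2 : ν ≤ ENNReal.ofReal (m + η) • μ) {h : X → ℝ} (hi : Integrable h μ) (h0 : ∀ x, 0 ≤ h x) :
    |∫ x, h x ∂ν - m * ∫ x, h x ∂μ| ≤ η * ∫ x, h x ∂μ := by
  have hi2 : Integrable h (ENNReal.ofReal (m + η) • μ) := hi.smul_measure ENNReal.ofReal_ne_top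
  have a1 := integral_mono_measure h1 (Eventually.of_forall h0) (hi2.mono_measure h2)
  have a2 := integral_mono_measure h2 (Eventually.of_forall h0) hi2
  rw [integral_smul_measure, ENNReal.toReal_ofReal (by linarith), smul_eq_mul] at a1 a2
  rw [abs_le]
  constructor <;> linarith

/-- Two measures with nearly constant density with respect to each other have nearly proportional
integrals. -/
lemma abs_integral_sub_le_of_measure_le {X : Type*} [MeasurableSpace X] {μ ν : Measure X} {m η : ℝ}
    (hη : 0 ≤ η) (hm : η ≤ m) (h1 : ENNReal.ofReal (m - η) • μ ≤ ν)
    (h2 : ν ≤ ENNReal.ofReal (m + η) • μ) {h : X → ℝ} (hi : Integrable h μ) :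
    |∫ x, h x ∂ν - m * ∫ x, h x ∂μ| ≤ η * ∫ x, |h x| ∂μ := by
  have hi2 : Integrable h ν :=
    (hi.smul_measure (ENNReal.ofReal_ne_top (r := m + η))).mono_measure h2
  -- Monotonicity in the measure requires a sign, so the positive and negative parts are compared
  -- separately.
  have hp := abs_integral_sub_le_of_nonneg hη hm h1 h2 hi.pos_part fun x => le_max_right (h x) 0
  have hn := abs_integral_sub_le_of_nonneg hη hm h1 h2 hi.neg_part fun x => le_max_right (-h x) 0
  have e1 : ∀ x, h x = max (h x) 0 - max (-h x) 0 := fun x => by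
    rcases le_total 0 (h x) with h' | h' <;> simp [h']
  have e2 : ∀ x, |h x| = max (h x) 0 + max (-h x) 0 := fun x => by
    rcases le_total 0 (h x) with h' | h' <;> simp [h', abs_of_nonneg, abs_of_nonpos]
  have i1 : ∫ x, h x ∂ν = ∫ x, max (h x) 0 ∂ν - ∫ x, max (-h x) 0 ∂ν := by
    rw [← integral_sub hi2.pos_part hi2.neg_part]
    exact integral_congr_ae (Eventually.of_forall e1)
  have i2 : ∫ x, h x ∂μ = ∫ x, max (h x) 0 ∂μ - ∫ x, max (-h x) 0 ∂μ := by
    rw [← integral_sub hi.pos_part hi.neg_part]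
    exact integral_congr_ae (Eventually.of_forall e1)
  have i3 : ∫ x, |h x| ∂μ = ∫ x, max (h x) 0 ∂μ + ∫ x, max (-h x) 0 ∂μ := by
    rw [← integral_add hi.pos_part hi.neg_part]
    exact integral_congr_ae (Eventually.of_forall e2)
  rw [i1, i2, i3]
  rw [abs_le] at hp hn ⊢
  constructor <;> linarith [hp.1, hp.2, hn.1, hn.2]

section NearlyStraight

variable {g : ℝ → E3} {p : E3} {η : ℝ}

/-- With the antilipschitz bound below, this squeezes `ℋ¹` on the curve between `(‖p‖ - η) ds` and
`(‖p‖ + η) ds`; `p` need not be the derivative of `g` anywhere. -/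
lemma lipschitzWith_of_nearly_straight (hη : 0 ≤ η)
    (hg : ∀ s s', ‖g s - g s' - (s - s') • p‖ ≤ η * |s - s'|) :
    LipschitzWith (Real.toNNReal (‖p‖ + η)) g := by
  refine LipschitzWith.of_dist_le_mul fun s s' => ?_
  rw [dist_eq_norm, Real.dist_eq, Real.coe_toNNReal _ (by positivity)]
  refine (norm_le_norm_sub_add _ ((s - s') • p)).trans ?_
  rw [norm_smul, Real.norm_eq_abs]
  linarith [hg s s']

lemma antilipschitzWith_of_nearly_straight (hη : η < ‖p‖)
    (hg : ∀ s s', ‖g s - g s' - (s - s') • p‖ ≤ η * |s - s'|) :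
    AntilipschitzWith (Real.toNNReal (‖p‖ - η))⁻¹ g := by
  refine AntilipschitzWith.of_le_mul_dist fun s s' => ?_
  rw [Real.dist_eq, dist_eq_norm, NNReal.coe_inv, Real.coe_toNNReal _ (by linarith),
    inv_mul_eq_div, le_div_iff₀ (by linarith)]
  have h1 : ‖(s - s') • p‖ ≤ ‖g s - g s' - (s - s') • p‖ + ‖g s - g s'‖ := by
    rw [← norm_neg (g s - g s' - (s - s') • p)]
    refine le_trans (le_of_eq ?_) (norm_add_le _ _)
    congr 1; module
  rw [norm_smul, Real.norm_eq_abs] at h1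
  linarith [hg s s']

lemma measurableEmbedding_of_nearly_straight (hη : 0 ≤ η) (hη' : η < ‖p‖)
    (hg : ∀ s s', ‖g s - g s' - (s - s') • p‖ ≤ η * |s - s'|) : MeasurableEmbedding g :=
  ((antilipschitzWith_of_nearly_straight hη' hg).isClosedEmbedding
    (lipschitzWith_of_nearly_straight hη hg).uniformContinuous).measurableEmbedding

lemma hausdorffMeasure_image_le_of_nearly_straight (hη : 0 ≤ η)
    (hg : ∀ s s', ‖g s - g s' - (s - s') • p‖ ≤ η * |s - s'|) (A : Set ℝ) :
    (Measure.hausdorffMeasure 1 : Measure E3) (g '' A) ≤ ENNReal.ofReal (‖p‖ + η) * volume A := by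
  have := (lipschitzWith_of_nearly_straight hη hg).hausdorffMeasure_image_le zero_le_one A
  rwa [ENNReal.rpow_one, hausdorffMeasure_real] at this

lemma le_hausdorffMeasure_image_of_nearly_straight (hη : η < ‖p‖)
    (hg : ∀ s s', ‖g s - g s' - (s - s') • p‖ ≤ η * |s - s'|) (A : Set ℝ) :
    ENNReal.ofReal (‖p‖ - η) * volume A ≤ (Measure.hausdorffMeasure 1 : Measure E3) (g '' A) := by
  have := (antilipschitzWith_of_nearly_straight hη hg).le_hausdorffMeasure_image zero_le_one A
  have h0 : Real.toNNReal (‖p‖ - η) ≠ 0 := by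
    rw [Ne, Real.toNNReal_eq_zero]; linarith
  rw [ENNReal.rpow_one, hausdorffMeasure_real, ENNReal.coe_inv h0] at this
  calc ENNReal.ofReal (‖p‖ - η) * volume A
      ≤ ENNReal.ofReal (‖p‖ - η) * ((ENNReal.ofReal (‖p‖ - η))⁻¹ *
        (Measure.hausdorffMeasure 1 : Measure E3) (g '' A)) := by gcongr; exact this
    _ = _ := by
      rw [← mul_assoc, ENNReal.mul_inv_cancel (by simpa using hη) ENNReal.ofReal_ne_top, one_mul]

/-- The line integral along a nearly straight curve is nearly `‖p‖` times the integral in the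
parameter. -/
lemma abs_integral_range_sub_le (hη : 0 ≤ η) (hη' : η < ‖p‖)
    (hg : ∀ s s', ‖g s - g s' - (s - s') • p‖ ≤ η * |s - s'|) {F : E3 → ℝ}
    (hF : Integrable (fun s => F (g s))) :
    |∫ y in range g, F y ∂(Measure.hausdorffMeasure 1 : Measure E3) - ‖p‖ * ∫ s, F (g s)| ≤
      η * ∫ s, |F (g s)| := by
  have hm := measurableEmbedding_of_nearly_straight hη hη' hg
  rw [← hm.map_comap, hm.integral_map]
  refine abs_integral_sub_le_of_measure_le hη hη'.le ?_ ?_ hF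
  · refine Measure.le_iff.2 fun A hA => ?_
    rw [hm.comap_apply, Measure.smul_apply, smul_eq_mul]
    exact le_hausdorffMeasure_image_of_nearly_straight hη' hg A
  · refine Measure.le_iff.2 fun A hA => ?_
    rw [hm.comap_apply, Measure.smul_apply, smul_eq_mul]
    exact hausdorffMeasure_image_le_of_nearly_straight hη hg A

variable {x₀ V : E3} {ε r R : ℝ}

lemma abs_parameter_le_of_norm_le (hη' : η ≤ ‖p‖ / 2) (hp : 0 < ‖p‖) (hε : 0 < ε)
    (hr0 : 0 ≤ r) (hr1 : r ≤ 1)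
    (hg : ∀ s s', ‖g s - g s' - (s - s') • p‖ ≤ η * |s - s'|)
    (hg0 : ‖g 0 - x₀ - (ε * r) • V‖ ≤ η * (ε * r)) {s : ℝ} (hs : ‖g s - x₀‖ ≤ R * ε) :
    |s| ≤ 2 * (R + ‖V‖ + ‖p‖) / ‖p‖ * ε := by
  have h0 : ‖g 0 - x₀‖ ≤ (‖V‖ + ‖p‖) * ε := by
    refine (norm_le_norm_sub_add _ ((ε * r) • V)).trans ?_
    rw [norm_smul, Real.norm_of_nonneg (by positivity)]
    have hεr : ε * r ≤ ε := mul_le_of_le_one_right hε.le hr1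
    have h1 : η * (ε * r) ≤ ‖p‖ * ε :=
      mul_le_mul (by linarith) hεr (by positivity) hp.le
    have h2 : ε * r * ‖V‖ ≤ ε * ‖V‖ := by gcongr
    linarith
  have := abs_parameter_le hη' hg h0 hs
  rw [div_mul_eq_mul_div, le_div_iff₀ hp]
  linarith

lemma hausdorffMeasure_range_inter_ball_le (hη : 0 ≤ η) (hη' : η ≤ ‖p‖ / 2) (hp : 0 < ‖p‖)
    (hε : 0 < ε) (hr0 : 0 ≤ r) (hr1 : r ≤ 1)
    (hg : ∀ s s', ‖g s - g s' - (s - s') • p‖ ≤ η * |s - s'|)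
    (hg0 : ‖g 0 - x₀ - (ε * r) • V‖ ≤ η * (ε * r)) :
    (Measure.hausdorffMeasure 1 : Measure E3) (range g ∩ Metric.ball x₀ (R * ε)) ≤
      ENNReal.ofReal (8 * (R + ‖V‖ + ‖p‖) * ε) := by
  obtain ⟨S, hS⟩ : ∃ S, S = 2 * (R + ‖V‖ + ‖p‖) / ‖p‖ := ⟨_, rfl⟩
  have hsub : range g ∩ Metric.ball x₀ (R * ε) ⊆ g '' Icc (-(S * ε)) (S * ε) := by
    rintro y ⟨⟨s, rfl⟩, hs⟩
    rw [mem_ball_iff_norm] at hs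
    have := abs_parameter_le_of_norm_le hη' hp hε hr0 hr1 hg hg0 hs.le
    rw [← hS] at this
    exact ⟨s, abs_le.1 this, rfl⟩
  refine (measure_mono hsub).trans
    ((hausdorffMeasure_image_le_of_nearly_straight hη hg _).trans ?_)
  rw [Real.volume_Icc, ← ENNReal.ofReal_mul (by positivity)]
  have hSp : S * ‖p‖ = 2 * (R + ‖V‖ + ‖p‖) := by rw [hS]; field_simp
  -- No sign of `R` is assumed; for `S < 0` the parameter interval has length zero.
  by_cases hS0 : 0 ≤ S
  · refine ENNReal.ofReal_le_ofReal ?_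
    calc (‖p‖ + η) * (S * ε - -(S * ε)) ≤ (‖p‖ + ‖p‖) * (S * ε - -(S * ε)) := by
          gcongr
          · have : 0 ≤ S * ε := by positivity
            linarith
          · linarith
      _ = 4 * (S * ‖p‖) * ε := by ring
      _ = _ := by rw [hSp]; ring
  · rw [ENNReal.ofReal_of_nonpos]
    · exact zero_le
    · have : S * ε ≤ 0 := mul_nonpos_of_nonpos_of_nonneg (by linarith) hε.le
      exact mul_nonpos_of_nonneg_of_nonpos (by positivity) (by linarith)

/-- Blow-up of the line integral along a nearly straight curve. -/
lemma abs_integral_range_rescaled_sub_le (hη : 0 ≤ η) (hη' : η ≤ ‖p‖ / 2) (hp : 0 < ‖p‖)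
    (hε : 0 < ε) (hr0 : 0 ≤ r) (hr1 : r ≤ 1)
    (hg : ∀ s s', ‖g s - g s' - (s - s') • p‖ ≤ η * |s - s'|)
    (hg0 : ‖g 0 - x₀ - (ε * r) • V‖ ≤ η * (ε * r)) {f : E3 → ℝ} {L : NNReal}
    (hL : LipschitzWith L f) {M : ℝ} (hM : ∀ z, |f z| ≤ M) (hR0 : 0 ≤ R)
    (hR : ∀ z, R ≤ ‖z‖ → f z = 0) {S : ℝ} (hS : S = 2 * (R + ‖V‖ + ‖p‖) / ‖p‖) :
    |∫ y in range g, f (ε⁻¹ • (y - x₀)) ∂(Measure.hausdorffMeasure 1 : Measure E3) -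
      ‖p‖ * (ε * ∫ s : ℝ, f (s • p + r • V))| ≤ η * (2 * S * (M + ‖p‖ * (L * (S + 1)))) * ε := by
  have hgc := (lipschitzWith_of_nearly_straight hη hg).continuous
  have hS0 : 0 < S := by rw [hS]; positivity
  have hSp : S * ‖p‖ = 2 * (R + ‖V‖ + ‖p‖) := by rw [hS]; field_simp
  have hεn : ‖ε⁻¹‖ = ε⁻¹ := Real.norm_of_nonneg (by positivity)
  obtain ⟨h, hh⟩ : ∃ h : ℝ → ℝ, h = fun s => f (ε⁻¹ • (g s - x₀)) := ⟨_, rfl⟩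
  obtain ⟨k, hk⟩ : ∃ k : ℝ → ℝ, k = fun s => f ((s / ε) • p + r • V) := ⟨_, rfl⟩
  set I := Icc (-(S * ε)) (S * ε) with hI
  have hIvol : volume.real I = 2 * S * ε := by
    rw [hI, Real.volume_real_Icc_of_le (by have : 0 ≤ S * ε := by positivity
                                           linarith)]
    ring
  have hh0 : ∀ s, s ∉ I → h s = 0 := by
    intro s hs
    rw [hh]
    refine hR _ ?_
    rw [norm_smul, hεn, ← div_eq_inv_mul, le_div_iff₀ hε]
    by_contra! hlt
    have := abs_parameter_le_of_norm_le hη' hp hε hr0 hr1 hg hg0 hlt.le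
    rw [← hS] at this
    exact hs (abs_le.1 this)
  have hk0 : ∀ s, s ∉ I → k s = 0 := by
    intro s hs
    rw [hk]
    refine hR _ ?_
    by_contra! hlt
    have h1 : ‖(s / ε) • p‖ ≤ ‖(s / ε) • p + r • V‖ + ‖r • V‖ := by
      simpa using norm_sub_le ((s / ε) • p + r • V) (r • V)
    rw [norm_smul, norm_smul, Real.norm_eq_abs, Real.norm_of_nonneg hr0, abs_div,
      abs_of_pos hε] at h1
    have h2 : r * ‖V‖ ≤ ‖V‖ := mul_le_of_le_one_left (norm_nonneg _) hr1
    refine hs (abs_le.1 ?_)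
    rw [← div_le_iff₀ hε]
    refine le_of_mul_le_mul_right ?_ hp
    rw [hSp]
    linarith [norm_nonneg V]
  have hhc : Continuous h := by
    rw [hh]; exact hL.continuous.comp (by fun_prop)
  have hkc : Continuous k := by
    rw [hk]; exact hL.continuous.comp (by fun_prop)
  have hhi : Integrable h := hhc.integrable_of_hasCompactSupport
    (HasCompactSupport.intro isCompact_Icc hh0)
  have hki : Integrable k := hkc.integrable_of_hasCompactSupport
    (HasCompactSupport.intro isCompact_Icc hk0)
  -- Three replacements: `ℋ¹` by `‖p‖ ds` (`e1`), the curve by the model line using the Lipschitz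
  -- bound on `f` (`e2`), and the exact substitution `s ↦ ε s` (`e3`). The first two cost `O(η ε)`,
  -- as both integrands live on `I`, of length `2 S ε`.
  have e1 : |∫ y in range g, f (ε⁻¹ • (y - x₀)) ∂(Measure.hausdorffMeasure 1 : Measure E3) -
      ‖p‖ * ∫ s, h s| ≤ η * (M * (2 * S * ε)) := by
    have := abs_integral_range_sub_le hη (by linarith) hg (F := fun y => f (ε⁻¹ • (y - x₀)))
      (by rw [hh] at hhi; exact hhi)
    rw [hh]
    refine this.trans (mul_le_mul_of_nonneg_left ?_ hη)
    have h2 : ∫ s, |f (ε⁻¹ • (g s - x₀))| = ∫ s in I, |f (ε⁻¹ • (g s - x₀))| := by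
      refine (setIntegral_eq_integral_of_forall_compl_eq_zero fun s hs => ?_).symm
      have := hh0 s hs
      rw [hh] at this
      simp only at this
      rw [this, abs_zero]
    rw [h2, ← hIvol]
    refine (le_abs_self _).trans ?_
    rw [← Real.norm_eq_abs]
    refine norm_setIntegral_le_of_norm_le_const isCompact_Icc.measure_lt_top fun s _ => ?_
    rw [Real.norm_eq_abs, abs_abs]
    exact hM _
  have e2 : |(∫ s, h s) - ∫ s, k s| ≤ η * (L * (S + 1)) * (2 * S * ε) := by
    rw [← integral_sub hhi hki]
    have h2 : ∫ s, (h s - k s) = ∫ s in I, (h s - k s) :=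
      (setIntegral_eq_integral_of_forall_compl_eq_zero fun s hs => by
        rw [hh0 s hs, hk0 s hs, sub_zero]).symm
    rw [h2, ← hIvol, ← Real.norm_eq_abs]
    refine norm_setIntegral_le_of_norm_le_const isCompact_Icc.measure_lt_top fun s hs => ?_
    rw [hh, hk]
    have h3 := hL.dist_le_mul (ε⁻¹ • (g s - x₀)) ((s / ε) • p + r • V)
    rw [Real.dist_eq, dist_eq_norm] at h3
    rw [Real.norm_eq_abs]
    refine h3.trans ?_
    have h4 : ε⁻¹ • (g s - x₀) - ((s / ε) • p + r • V) =
        ε⁻¹ • ((g s - g 0 - (s - 0) • p) + (g 0 - x₀ - (ε * r) • V)) := by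
      have : r • V = ε⁻¹ • (ε * r) • V := by rw [smul_smul, inv_mul_cancel_left₀ hε.ne']
      rw [this, div_eq_inv_mul]
      module
    have h5 : ‖ε⁻¹ • (g s - x₀) - ((s / ε) • p + r • V)‖ ≤ η * (S + 1) := by
      rw [h4, norm_smul, hεn, ← div_eq_inv_mul, div_le_iff₀ hε]
      refine (norm_add_le _ _).trans ((add_le_add (hg s 0) hg0).trans ?_)
      rw [sub_zero]
      have h6 : |s| ≤ S * ε := abs_le.2 hs
      have h7 : ε * r ≤ ε := mul_le_of_le_one_right hε.le hr1
      calc η * |s| + η * (ε * r) ≤ η * (S * ε) + η * ε := by gcongr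
        _ = _ := by ring
    calc (L : ℝ) * _ ≤ L * (η * (S + 1)) := by gcongr
      _ = _ := by ring
  have e3 : ∫ s, k s = ε * ∫ s : ℝ, f (s • p + r • V) := by
    rw [hk]
    have := Measure.integral_comp_mul_left (fun s => f (s • p + r • V)) ε⁻¹
    rw [inv_inv, abs_of_pos hε, smul_eq_mul] at this
    rw [← this]
    simp only [div_eq_inv_mul]
  rw [← e3]
  calc _ ≤ |∫ y in range g, f (ε⁻¹ • (y - x₀)) ∂(Measure.hausdorffMeasure 1 : Measure E3) -
        ‖p‖ * ∫ s, h s| + ‖p‖ * |(∫ s, h s) - ∫ s, k s| := by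
        rw [← abs_of_pos hp, ← abs_mul, abs_of_pos hp]
        refine le_trans (le_of_eq ?_) (abs_add_le _ _)
        congr 1; ring
    _ ≤ η * (M * (2 * S * ε)) + ‖p‖ * (η * (L * (S + 1)) * (2 * S * ε)) := by gcongr
    _ = _ := by ring

end NearlyStraight

/-! ### Blow-up at a point of the moving curve -/

/-- Blow-up of the integrals over a moving curve at a point where it has a first order model. -/
lemma HasFirstOrderModel.exists_blowUp_estimate {Te : ℝ} {ℓ : ℝ → Set E3} {τ : ℝ → E3 → E3}
    {t₀ : ℝ} {x₀ p V : E3} (h : HasFirstOrderModel Te ℓ τ t₀ x₀ p V) (hp : 0 < ‖p‖)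
    (hℓ : ∀ t ∈ Ico 0 Te, MeasurableSet (ℓ t)) {A : ℝ → E3 → E3} {A₀ : E3}
    (hA : ∀ κ : ℝ, 0 < κ → ∃ δ : ℝ, 0 < δ ∧ ∀ t ∈ Ico 0 Te, |t - t₀| < δ →
      ∀ y ∈ ℓ t, y ∈ Metric.ball x₀ δ → ‖A t y - A₀‖ ≤ κ)
    {Φ : ℝ → E3 → E3} {L : NNReal} (hL : ∀ r, LipschitzWith L (Φ r)) {M : ℝ}
    (hM : ∀ r z, ‖Φ r z‖ ≤ M) {R : ℝ} (hR0 : 0 < R) (hR : ∀ r z, R ≤ ‖z‖ → Φ r z = 0)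
    {κ : ℝ} (hκ : 0 < κ) :
    ∃ ε₀ : ℝ, 0 < ε₀ ∧ ∀ ε, 0 < ε → ε < ε₀ → ∀ t ∈ Ico 0 Te, t₀ ≤ t → t ≤ t₀ + ε →
      Integrable (fun y => inner ℝ (A t y) (Φ ((t - t₀) / ε) (ε⁻¹ • (y - x₀))))
        ((Measure.hausdorffMeasure 1 : Measure E3).restrict (ℓ t)) →
      |∫ y in ℓ t, inner ℝ (A t y) (Φ ((t - t₀) / ε) (ε⁻¹ • (y - x₀)))
          ∂(Measure.hausdorffMeasure 1 : Measure E3) -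
        ‖p‖ * (ε * ∫ s : ℝ, inner ℝ A₀ (Φ ((t - t₀) / ε) (s • p + ((t - t₀) / ε) • V)))| ≤
        κ * ε := by
  have hM0 : 0 ≤ M := (norm_nonneg _).trans (hM 0 0)
  obtain ⟨S, hS⟩ : ∃ S, S = 2 * (R + ‖V‖ + ‖p‖) / ‖p‖ := ⟨_, rfl⟩
  have hS0 : 0 < S := by rw [hS]; positivity
  -- `K₁` is the cost of straightening the curve. `K₂` is the cost of freezing `A` at `A₀`: the
  -- bound on `Φ` times the bound, per unit `ε`, on the length of the curve in the ball of radius `R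
  -- ε`.
  obtain ⟨K₁, hK₁⟩ : ∃ K₁ : ℝ,
      K₁ = 2 * S * (‖A₀‖ * M + ‖p‖ * ((‖A₀‖₊ * L : NNReal) * (S + 1))) := ⟨_, rfl⟩
  obtain ⟨K₂, hK₂⟩ : ∃ K₂ : ℝ, K₂ = M * (8 * (R + ‖V‖ + ‖p‖)) := ⟨_, rfl⟩
  have hK₁0 : 0 ≤ K₁ := by rw [hK₁]; positivity
  have hK₂0 : 0 ≤ K₂ := by rw [hK₂]; positivity
  obtain ⟨η, hη, hηp, hηK⟩ : ∃ η : ℝ, 0 < η ∧ η ≤ ‖p‖ / 2 ∧ η ≤ κ / (K₁ + K₂ + 1) :=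
    ⟨min (‖p‖ / 2) (κ / (K₁ + K₂ + 1)), by positivity, min_le_left _ _, min_le_right _ _⟩
  have hηκ : η * K₁ + η * K₂ ≤ κ := by
    rw [le_div_iff₀ (by positivity)] at hηK
    linarith
  obtain ⟨δ₁, hδ₁, hmod⟩ := h η hη
  obtain ⟨δ₂, hδ₂, hAη⟩ := hA η hη
  refine ⟨min (min δ₁ δ₂) (min (δ₁ / R) (δ₂ / R)), by positivity,
    fun ε hε hεε t ht ht0 ht1 hint => ?_⟩
  have hε1 : ε < δ₁ := hεε.trans_le ((min_le_left _ _).trans (min_le_left _ _))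
  have hε2 : ε < δ₂ := hεε.trans_le ((min_le_left _ _).trans (min_le_right _ _))
  have hε3 : R * ε < δ₁ := by
    rw [mul_comm]
    exact (lt_div_iff₀ hR0).1 (hεε.trans_le ((min_le_right _ _).trans (min_le_left _ _)))
  have hε4 : R * ε < δ₂ := by
    rw [mul_comm]
    exact (lt_div_iff₀ hR0).1 (hεε.trans_le ((min_le_right _ _).trans (min_le_right _ _)))
  have habs : |t - t₀| ≤ ε := by rw [abs_of_nonneg (by linarith)]; linarith
  obtain ⟨g, hg, hg0, hgr⟩ := hmod t ht (by linarith)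
  obtain ⟨r, hr⟩ : ∃ r, r = (t - t₀) / ε := ⟨_, rfl⟩
  have hεr : t - t₀ = ε * r := by rw [hr]; field_simp
  have hr0 : 0 ≤ r := by rw [hr]; exact div_nonneg (by linarith) hε.le
  have hr1 : r ≤ 1 := by rw [hr, div_le_one hε]; linarith
  rw [hεr, abs_of_nonneg (by positivity)] at hg0
  rw [← hr] at hint ⊢
  set μ : Measure E3 := Measure.hausdorffMeasure 1 with hμ
  set B := Metric.ball x₀ (R * ε) with hB
  have hout : ∀ y, y ∉ B → Φ r (ε⁻¹ • (y - x₀)) = 0 := by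
    intro y hy
    refine hR _ _ ?_
    rw [norm_smul, Real.norm_of_nonneg (by positivity), ← div_eq_inv_mul, le_div_iff₀ hε]
    rwa [hB, mem_ball_iff_norm, not_lt] at hy
  have hset : ℓ t ∩ B = range g ∩ B := by
    ext y
    constructor
    · rintro ⟨h1, h2⟩
      exact ⟨(hgr y (Metric.ball_subset_ball hε3.le h2)).1.1 h1, h2⟩
    · rintro ⟨h1, h2⟩
      exact ⟨(hgr y (Metric.ball_subset_ball hε3.le h2)).1.2 h1, h2⟩
  have hrange : MeasurableSet (range g) :=
    (measurableEmbedding_of_nearly_straight hη.le (by linarith) hg).measurableSet_range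
  have hvol := hausdorffMeasure_range_inter_ball_le (R := R) hη.le hηp hp hε hr0 hr1 hg hg0
  have hfin : μ (range g ∩ B) < ⊤ := hvol.trans_lt ENNReal.ofReal_lt_top
  have hvol' : μ.real (range g ∩ B) ≤ 8 * (R + ‖V‖ + ‖p‖) * ε :=
    ENNReal.toReal_le_of_le_ofReal (by positivity) hvol
  have hfL : LipschitzWith (‖A₀‖₊ * L) (fun z => (inner ℝ A₀ (Φ r z) : ℝ)) :=
    LipschitzWith.of_dist_le_mul fun z z' => by
      rw [Real.dist_eq, ← inner_sub_right, NNReal.coe_mul, coe_nnnorm, mul_assoc]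
      refine (abs_real_inner_le_norm _ _).trans ?_
      rw [← dist_eq_norm]
      gcongr
      exact (hL r).dist_le_mul z z'
  have hest := abs_integral_range_rescaled_sub_le hη.le hηp hp hε hr0 hr1 hg hg0 hfL
    (M := ‖A₀‖ * M) (fun z => (abs_real_inner_le_norm _ _).trans (by gcongr; exact hM r z)) hR0.le
    (fun z hz => by rw [hR r z hz, inner_zero_right]) hS
  rw [← hK₁] at hest
  have e1 : ∫ y in ℓ t, inner ℝ (A t y) (Φ r (ε⁻¹ • (y - x₀))) ∂μ =
      ∫ y in range g ∩ B, inner ℝ (A t y) (Φ r (ε⁻¹ • (y - x₀))) ∂μ := by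
    rw [← hset]
    refine setIntegral_eq_of_subset_of_forall_sdiff_eq_zero (hℓ t ht) inter_subset_left ?_
    rintro y ⟨hy1, hy2⟩
    rw [hout y fun hyB => hy2 ⟨hy1, hyB⟩, inner_zero_right]
  have e2 : ∫ y in range g, inner ℝ A₀ (Φ r (ε⁻¹ • (y - x₀))) ∂μ =
      ∫ y in range g ∩ B, inner ℝ A₀ (Φ r (ε⁻¹ • (y - x₀))) ∂μ := by
    refine setIntegral_eq_of_subset_of_forall_sdiff_eq_zero hrange inter_subset_left ?_
    rintro y ⟨hy1, hy2⟩
    rw [hout y fun hyB => hy2 ⟨hy1, hyB⟩, inner_zero_right]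
  have i1 : IntegrableOn (fun y => (inner ℝ (A t y) (Φ r (ε⁻¹ • (y - x₀))) : ℝ))
      (range g ∩ B) μ := by
    rw [← hset]
    exact IntegrableOn.mono_set hint inter_subset_left
  have i2 : IntegrableOn (fun y => (inner ℝ A₀ (Φ r (ε⁻¹ • (y - x₀))) : ℝ))
      (range g ∩ B) μ := by
    refine Measure.integrableOn_of_bounded (M := ‖A₀‖ * M) hfin.ne ?_ ?_
    · exact (hfL.continuous.comp (by fun_prop :
        Continuous fun y : E3 => ε⁻¹ • (y - x₀))).aestronglyMeasurable
    · exact Eventually.of_forall fun y =>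
        (abs_real_inner_le_norm _ _).trans (by gcongr; exact hM r _)
  have e3 : |∫ y in range g ∩ B, inner ℝ (A t y) (Φ r (ε⁻¹ • (y - x₀))) ∂μ -
      ∫ y in range g ∩ B, inner ℝ A₀ (Φ r (ε⁻¹ • (y - x₀))) ∂μ| ≤ η * K₂ * ε := by
    rw [← integral_sub i1 i2, ← Real.norm_eq_abs]
    refine (norm_setIntegral_le_of_norm_le_const (C := η * M) hfin fun y hy => ?_).trans ?_
    · rw [← inner_sub_left]
      refine (norm_inner_le_norm _ _).trans ?_
      rw [← hset] at hy
      gcongr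
      · exact hAη t ht (by linarith) y hy.1 (Metric.ball_subset_ball hε4.le hy.2)
      · exact hM r _
    · calc η * M * μ.real (range g ∩ B) ≤ η * M * (8 * (R + ‖V‖ + ‖p‖) * ε) := by gcongr
        _ = η * K₂ * ε := by rw [hK₂]; ring
  rw [e1]
  rw [e2] at hest
  calc _ ≤ η * K₂ * ε + η * K₁ * ε := by
        rw [abs_le] at hest e3 ⊢
        constructor <;> linarith [hest.1, hest.2, e3.1, e3.2]
    _ = (η * K₁ + η * K₂) * ε := by ring
    _ ≤ κ * ε := by gcongr

/-! ### Rescaled test fields -/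

/-- The vector product of the spatial part of a covector with `e`. -/
def curlPart (e : E3) (B : ℝ × E3 →L[ℝ] ℝ) : E3 :=
  cross (WithLp.toLp 2 fun i => B (0, EuclideanSpace.single i 1)) e

/-- The temporal part of a covector times `e`. -/
def timePart (e : E3) (B : ℝ × E3 →L[ℝ] ℝ) : E3 := B (1, 0) • e

lemma contDiff_curlPart (e : E3) {n : WithTop ℕ∞} : ContDiff ℝ n (curlPart e) := by
  have hB : ∀ q : ℝ × E3, ContDiff ℝ n fun B : ℝ × E3 →L[ℝ] ℝ => B q := fun q =>
    contDiff_id.clm_apply contDiff_const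
  rw [contDiff_euclidean]
  intro i
  fin_cases i <;> simp [curlPart, cross, crossProduct] <;>
    exact ((hB _).mul contDiff_const).sub ((hB _).mul contDiff_const)

lemma contDiff_timePart (e : E3) {n : WithTop ℕ∞} : ContDiff ℝ n (timePart e) :=
  (contDiff_id.clm_apply contDiff_const).smul contDiff_const

lemma curlPart_zero (e : E3) : curlPart e 0 = 0 := by
  ext i
  fin_cases i <;> simp [curlPart, cross, crossProduct]

lemma timePart_zero (e : E3) : timePart e 0 = 0 := by simp [timePart]

lemma rot_smul_const {f : E3 → ℝ} {x : E3} (hf : DifferentiableAt ℝ f x) (e : E3) :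
    rot (fun y => f y • e) x =
      cross (WithLp.toLp 2 fun i => fderiv ℝ f x (EuclideanSpace.single i 1)) e := by
  have h : ∀ i j, partialD i j (fun y => f y • e) x =
      fderiv ℝ f x (EuclideanSpace.single i 1) * e j := by
    intro i j
    simp [partialD, fderiv_smul_const hf e]
  ext i
  fin_cases i <;> simp [rot, h, cross, crossProduct]

/-- The test field `(t, y) ↦ ε ψ((t - t₀)/ε, (y - x₀)/ε) e`. -/
def rescaledField (ψ : ℝ × E3 → ℝ) (e x₀ : E3) (t₀ ε : ℝ) (t : ℝ) (y : E3) : E3 :=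
  (ε * ψ ((t - t₀) / ε, ε⁻¹ • (y - x₀))) • e

section Rescaled

variable {ψ : ℝ × E3 → ℝ} {e x₀ : E3} {t₀ ε : ℝ}

/-- The prefactor `ε` cancels the `ε⁻¹` of the chain rule, so first derivatives keep their size
under the blow-up. -/
lemma deriv_rescaledField (hψ : Differentiable ℝ ψ) (hε : ε ≠ 0) (t : ℝ) (y : E3) :
    deriv (fun r => rescaledField ψ e x₀ t₀ ε r y) t =
      timePart e (fderiv ℝ ψ ((t - t₀) / ε, ε⁻¹ • (y - x₀))) := by
  have h1 : HasDerivAt (fun r : ℝ => ((r - t₀) / ε, ε⁻¹ • (y - x₀))) ((1 / ε, 0) : ℝ × E3) t :=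
    (((hasDerivAt_id t).sub_const t₀).div_const ε).prodMk (hasDerivAt_const t _)
  have h2 := ((((hψ _).hasFDerivAt.comp_hasDerivAt t h1).const_mul ε).smul_const e).deriv
  refine h2.trans ?_
  have h3 : ((1 / ε, 0) : ℝ × E3) = ε⁻¹ • ((1, 0) : ℝ × E3) := by simp
  rw [timePart, h3, map_smul, smul_eq_mul, mul_inv_cancel_left₀ hε]

lemma rot_rescaledField (hψ : Differentiable ℝ ψ) (hε : ε ≠ 0) (t : ℝ) (y : E3) :
    rot (rescaledField ψ e x₀ t₀ ε t) y =
      curlPart e (fderiv ℝ ψ ((t - t₀) / ε, ε⁻¹ • (y - x₀))) := by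
  have h1 : HasFDerivAt (fun y : E3 => (((t - t₀) / ε, ε⁻¹ • (y - x₀)) : ℝ × E3))
      ((0 : E3 →L[ℝ] ℝ).prod (ε⁻¹ • ContinuousLinearMap.id ℝ E3)) y :=
    (hasFDerivAt_const _ _).prodMk (((hasFDerivAt_id y).sub_const x₀).const_smul ε⁻¹)
  have h2 := ((hψ _).hasFDerivAt.comp y h1).const_mul ε
  refine (rot_smul_const h2.differentiableAt e).trans ?_
  rw [h2.fderiv, curlPart]
  congr 2
  ext i
  have h3 : ((0, ε⁻¹ • EuclideanSpace.single i 1) : ℝ × E3) =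
    ε⁻¹ • ((0, EuclideanSpace.single i 1) : ℝ × E3) := by simp
  simp only [smul_apply, ContinuousLinearMap.comp_apply,
    ContinuousLinearMap.prod_apply, zero_apply, ContinuousLinearMap.id_apply,
    h3, map_smul, smul_eq_mul, mul_inv_cancel_left₀ hε]

lemma isSpaceTimeTestField_rescaledField {Ω : Set E3} {Te a d R : ℝ}
    (hψ : ContDiff ℝ ((⊤ : ℕ∞) : WithTop ℕ∞) ψ)
    (hsupp : ∀ r z, ψ (r, z) ≠ 0 → r ∈ Icc a d ∧ ‖z‖ ≤ R) (hε : 0 < ε)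
    (ha : 0 < t₀ + ε * a) (hd : t₀ + ε * d < Te) (hR : Metric.closedBall x₀ (ε * R) ⊆ Ω) :
    IsSpaceTimeTestField Te Ω (rescaledField ψ e x₀ t₀ ε) := by
  have hsub : Function.support (Function.uncurry (rescaledField ψ e x₀ t₀ ε)) ⊆
      Icc (t₀ + ε * a) (t₀ + ε * d) ×ˢ Metric.closedBall x₀ (ε * R) := by
    rintro ⟨t, y⟩ hty
    have h0 : ψ ((t - t₀) / ε, ε⁻¹ • (y - x₀)) ≠ 0 := by
      intro h0
      exact hty (by simp [Function.uncurry, rescaledField, h0])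
    obtain ⟨⟨h1, h2⟩, h3⟩ := hsupp _ _ h0
    rw [le_div_iff₀ hε] at h1
    rw [div_le_iff₀ hε] at h2
    rw [norm_smul, Real.norm_of_nonneg (by positivity), ← div_eq_inv_mul, div_le_iff₀ hε] at h3
    refine ⟨⟨by linarith, by linarith⟩, ?_⟩
    rw [mem_closedBall_iff_norm]
    linarith
  have hK : IsCompact (Icc (t₀ + ε * a) (t₀ + ε * d) ×ˢ Metric.closedBall x₀ (ε * R)) :=
    isCompact_Icc.prod (isCompact_closedBall _ _)
  refine ⟨?_, HasCompactSupport.of_support_subset_isCompact hK hsub, ?_⟩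
  · have : ContDiff ℝ ((⊤ : ℕ∞) : WithTop ℕ∞)
        fun q : ℝ × E3 => (((q.1 - t₀) / ε, ε⁻¹ • (q.2 - x₀)) : ℝ × E3) := by fun_prop
    exact (contDiff_const.mul (hψ.comp this)).smul contDiff_const
  · refine (closure_minimal hsub hK.isClosed).trans (prod_mono ?_ hR)
    exact fun t ht => ⟨ha.trans_le ht.1, ht.2.trans_lt hd⟩

end Rescaled

/-! ### Vector algebra -/

lemma inner_cross_cross (x y z w : E3) :
    (inner ℝ (cross x y) (cross z w) : ℝ) = inner ℝ x z * inner ℝ y w - inner ℝ y z * inner ℝ x w := by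
  simp [cross, crossProduct, PiLp.inner_apply, Fin.sum_univ_three]
  ring

lemma inner_cross_cyclic (x y z : E3) :
    (inner ℝ x (cross y z) : ℝ) = inner ℝ (cross z x) y := by
  simp [cross, crossProduct, PiLp.inner_apply, Fin.sum_univ_three]
  ring

lemma inner_cross_self_left (x y : E3) : (inner ℝ (cross x y) x : ℝ) = 0 := by
  simp [cross, crossProduct, PiLp.inner_apply, Fin.sum_univ_three]
  ring

lemma cross_cross_left (x y z : E3) :
    cross (cross x y) z = (inner ℝ x z : ℝ) • y - (inner ℝ y z : ℝ) • x := by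
  ext i
  fin_cases i <;> simp [cross, crossProduct, PiLp.inner_apply, Fin.sum_univ_three] <;> ring

lemma cross_cross_right (x y z : E3) :
    cross x (cross y z) = (inner ℝ x z : ℝ) • y - (inner ℝ x y : ℝ) • z := by
  ext i
  fin_cases i <;> simp [cross, crossProduct, PiLp.inner_apply, Fin.sum_univ_three] <;> ring

lemma cross_zero_right (x : E3) : cross x 0 = 0 := by
  ext i
  fin_cases i <;> simp [cross, crossProduct]

lemma cross_smul_left (k : ℝ) (x y : E3) : cross (k • x) y = k • cross x y := by
  ext i
  fin_cases i <;> simp [cross, crossProduct, mul_sub]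

lemma projPerp_eq {u : E3} (hu : ‖u‖ = 1) (b : E3) : projPerp u b = b - (inner ℝ u b : ℝ) • u := by
  rw [projPerp, Submodule.starProjection_orthogonal_val, Submodule.starProjection_unit_singleton ℝ hu]

/-- A vector orthogonal to `u` and to `u × b` is parallel to the projection of `b`. -/
lemma isParallelTo_projPerp {u b v : E3} (hu : ‖u‖ = 1) (hb : ¬ IsParallelTo b u)
    (hv : inner ℝ v u = 0) (hvn : inner ℝ (cross u b) v = 0) : IsParallelTo v (projPerp u b) := by
  have hw : cross (cross u b) u = projPerp u b := by
    rw [cross_cross_left, projPerp_eq hu, real_inner_self_eq_norm_sq, hu, real_inner_comm]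
    simp
  set w := projPerp u b with hwdef
  have hw0 : w ≠ 0 := by
    intro h0
    apply hb
    rw [IsParallelTo, Submodule.mem_span_singleton]
    rw [hwdef, projPerp_eq hu, sub_eq_zero] at h0
    exact ⟨_, h0.symm⟩
  -- Since `w = (u × b) × u`, the product `w × v` is a combination of `u` and `u × b` with
  -- coefficients `(u × b) · v` and `-u · v`.
  have h1 : cross w v = 0 := by
    rw [← hw, cross_cross_left (cross u b) u v, hvn, real_inner_comm, hv]
    simp
  have h2 := cross_cross_right w w v
  rw [h1, cross_zero_right, eq_comm, sub_eq_zero] at h2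
  rw [IsParallelTo, Submodule.mem_span_singleton]
  have h3 : (inner ℝ w w : ℝ) ≠ 0 := by simpa using hw0
  refine ⟨(inner ℝ w w)⁻¹ * inner ℝ w v, ?_⟩
  rw [mul_smul, h2, smul_smul, inv_mul_cancel₀ h3, one_smul]

/-! ### The profile of the test field -/

lemma pairing_curveMeasure (b : E3) (ℓ : Set E3) (β φ : E3 → E3) :
    pairing (curveMeasure b ℓ) β φ =
      ‖b‖ * ∫ y in ℓ, inner ℝ (β y) (φ y) ∂(Measure.hausdorffMeasure 1 : Measure E3) := by
  rw [pairing, curveMeasure, integral_smul_nnreal_measure, NNReal.smul_def, coe_nnnorm, smul_eq_mul]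

lemma integrable_of_integrable_curveMeasure {b : E3} (hb : b ≠ 0) {ℓ : Set E3} {f : E3 → ℝ}
    (hf : Integrable f (curveMeasure b ℓ)) :
    Integrable f ((Measure.hausdorffMeasure 1 : Measure E3).restrict ℓ) :=
  (integrable_smul_measure (ENNReal.coe_ne_zero.2 (nnnorm_ne_zero_iff.2 hb))
    ENNReal.coe_ne_top).1 hf

/-- The profile `χ(r) β(z - r V) n · (z - r V)`, which vanishes along the lines of direction
orthogonal to `n` through `r V`. -/
def profile (χ : ContDiffBump (1 / 2 : ℝ)) (β : ContDiffBump (0 : E3)) (V n : E3) (q : ℝ × E3) : ℝ :=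
  χ q.1 * (β (q.2 - q.1 • V) * inner ℝ n (q.2 - q.1 • V))

section Profile

variable (χ : ContDiffBump (1 / 2 : ℝ)) (β : ContDiffBump (0 : E3)) {V n : E3}

lemma contDiff_profile : ContDiff ℝ ((⊤ : ℕ∞) : WithTop ℕ∞) (profile χ β V n) := by
  have h : ContDiff ℝ ((⊤ : ℕ∞) : WithTop ℕ∞) fun q : ℝ × E3 => q.2 - q.1 • V :=
    contDiff_snd.sub (contDiff_fst.smul contDiff_const)
  exact (χ.contDiff.comp contDiff_fst).mul
    ((β.contDiff.comp h).mul (contDiff_const.inner ℝ h))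

lemma profile_support {r : ℝ} {z : E3} (h : profile χ β V n (r, z) ≠ 0) :
    r ∈ Icc (1 / 2 - χ.rOut) (1 / 2 + χ.rOut) ∧
      ‖z‖ ≤ β.rOut + (1 / 2 + χ.rOut) * ‖V‖ := by
  have h1 : r ∈ Function.support χ := left_ne_zero_of_mul h
  have h2 : z - r • V ∈ Function.support β := left_ne_zero_of_mul (right_ne_zero_of_mul h)
  rw [χ.support_eq, Metric.mem_ball, Real.dist_eq, abs_lt] at h1
  rw [β.support_eq, mem_ball_zero_iff] at h2
  refine ⟨⟨by linarith, by linarith⟩, ?_⟩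
  have h3 := norm_le_norm_sub_add z (r • V)
  rw [norm_smul, Real.norm_eq_abs] at h3
  have h4 : |r| ≤ 1 / 2 + χ.rOut := abs_le.2 ⟨by linarith, by linarith⟩
  have h5 : |r| * ‖V‖ ≤ (1 / 2 + χ.rOut) * ‖V‖ := by gcongr
  linarith

lemma hasCompactSupport_profile : HasCompactSupport (profile χ β V n) :=
  HasCompactSupport.of_support_subset_isCompact
    (isCompact_Icc.prod (isCompact_closedBall (0 : E3) (β.rOut + (1 / 2 + χ.rOut) * ‖V‖)))
    fun ⟨_, _⟩ h => ⟨(profile_support χ β h).1,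
      mem_closedBall_zero_iff.2 (profile_support χ β h).2⟩

lemma fderiv_profile_eq_zero {r : ℝ} (hr : r ∉ Icc (1 / 2 - χ.rOut) (1 / 2 + χ.rOut)) (z : E3) :
    fderiv ℝ (profile χ β V n) (r, z) = 0 := by
  by_contra h
  have h1 := support_fderiv_subset ℝ (f := profile χ β V n) h
  have h2 : tsupport (profile χ β V n) ⊆
      Icc (1 / 2 - χ.rOut) (1 / 2 + χ.rOut) ×ˢ (univ : Set E3) :=
    closure_minimal (fun ⟨_, _⟩ h => ⟨(profile_support χ β h).1, mem_univ _⟩)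
      (isClosed_Icc.prod isClosed_univ)
  exact hr (h2 h1).1

/-- At points `z + r V` with `z ⊥ n` the linear factor vanishes, so the product rule leaves no
derivative of `χ` or `β`. -/
lemma fderiv_profile_apply {z : E3} (hz : inner ℝ n z = 0) (r : ℝ) (q : ℝ × E3) :
    fderiv ℝ (profile χ β V n) (r, z + r • V) q = χ r * β z * inner ℝ n (q.2 - q.1 • V) := by
  have hlin : HasFDerivAt (fun q : ℝ × E3 => q.2 - q.1 • V)
      (ContinuousLinearMap.snd ℝ ℝ E3 - (ContinuousLinearMap.fst ℝ ℝ E3).smulRight V)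
      (r, z + r • V) :=
    hasFDerivAt_snd.sub (hasFDerivAt_fst.smul_const V)
  have hχ : HasFDerivAt (fun q : ℝ × E3 => χ q.1) _ (r, z + r • V) :=
    HasFDerivAt.comp (g := (χ : ℝ → ℝ)) (f := Prod.fst) (r, z + r • V)
      ((χ.contDiff (n := 1)).differentiable one_ne_zero r).hasFDerivAt hasFDerivAt_fst
  have hβ : HasFDerivAt (fun q : ℝ × E3 => β (q.2 - q.1 • V)) _ (r, z + r • V) :=
    HasFDerivAt.comp (g := (β : E3 → ℝ)) (r, z + r • V)
      ((β.contDiff (n := 1)).differentiable one_ne_zero _).hasFDerivAt hlin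
  have hn : HasFDerivAt (fun q : ℝ × E3 => (inner ℝ n (q.2 - q.1 • V) : ℝ)) _ (r, z + r • V) :=
    (innerSL ℝ n).hasFDerivAt.comp (r, z + r • V) hlin
  have h : HasFDerivAt (profile χ β V n) _ (r, z + r • V) := hχ.mul (hβ.mul hn)
  rw [h.fderiv]
  simp [hz, mul_assoc, inner_sub_right, inner_smul_right]

lemma timePart_fderiv_profile (e : E3) {z : E3} (hz : inner ℝ n z = 0) (r : ℝ) :
    timePart e (fderiv ℝ (profile χ β V n) (r, z + r • V)) =
      (χ r * β z * -inner ℝ n V) • e := by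
  rw [timePart, fderiv_profile_apply χ β hz]
  simp

lemma curlPart_fderiv_profile (e : E3) {z : E3} (hz : inner ℝ n z = 0) (r : ℝ) :
    curlPart e (fderiv ℝ (profile χ β V n) (r, z + r • V)) = (χ r * β z) • cross n e := by
  rw [curlPart, ← cross_smul_left]
  congr 1
  ext i
  simp [fderiv_profile_apply χ β hz, EuclideanSpace.inner_single_right]

end Profile

/-- `P 0 = 0` preserves compact support in `(r, z)` jointly, which makes all bounds uniform in `r`.
-/
lemma exists_bounds_comp_fderiv {ψ : ℝ × E3 → ℝ} (hψ : ContDiff ℝ ((⊤ : ℕ∞) : WithTop ℕ∞) ψ)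
    (hc : HasCompactSupport ψ) {P : (ℝ × E3 →L[ℝ] ℝ) → E3} (hP : ContDiff ℝ 1 P) (hP0 : P 0 = 0) :
    ∃ L : NNReal, ∃ M R : ℝ, 0 < R ∧ (∀ r, LipschitzWith L fun z => P (fderiv ℝ ψ (r, z))) ∧
      (∀ r z, ‖P (fderiv ℝ ψ (r, z))‖ ≤ M) ∧
      ∀ r z, R ≤ ‖z‖ → P (fderiv ℝ ψ (r, z)) = 0 := by
  have hcs : HasCompactSupport fun q => P (fderiv ℝ ψ q) := (hc.fderiv ℝ).comp_left hP0
  have hcd : ContDiff ℝ 1 fun q => P (fderiv ℝ ψ q) :=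
    hP.comp (hψ.fderiv_right (m := 1) (WithTop.coe_le_coe.2 (le_top : (1 + 1 : ℕ∞) ≤ ⊤)))
  obtain ⟨L, hL⟩ := hcd.lipschitzWith_of_hasCompactSupport hcs one_ne_zero
  obtain ⟨M, hM⟩ := hcs.exists_bound_of_continuous hcd.continuous
  obtain ⟨R, hR⟩ := hcs.isCompact.isBounded.subset_closedBall 0
  refine ⟨L, M, max R 0 + 1, by positivity, fun r => LipschitzWith.of_dist_le_mul fun z z' => ?_,
    fun r z => hM _, fun r z hz => ?_⟩
  · simpa [Prod.dist_eq] using hL.dist_le_mul (r, z) (r, z')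
  · by_contra hne
    have h1 := hR (subset_tsupport _ hne)
    rw [mem_closedBall_zero_iff] at h1
    have h2 : ‖z‖ ≤ ‖((r, z) : ℝ × E3)‖ := le_max_right _ _
    linarith [le_max_left R 0]

/-- If a function on an interval of length `ε` has mean zero and is close to a multiple of a bump
function, then the factor is small. -/
lemma abs_mul_integral_le_of_integral_eq_zero {χ F : ℝ → ℝ} {t₀ ε κ D : ℝ} {s : Set ℝ}
    (hε : 0 < ε) (hχ : Continuous χ)
    (hχ0 : ∀ r, r ∉ Ioo (0 : ℝ) 1 → χ r = 0) (hs : MeasurableSet s)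
    (hJ : Ioo t₀ (t₀ + ε) ⊆ s) (hF : IntegrableOn F s) (hF0 : ∫ t in s, F t = 0)
    (hFJ : ∀ t ∈ s, t ∉ Ioo t₀ (t₀ + ε) → F t = 0)
    (hFχ : ∀ t ∈ Ioo t₀ (t₀ + ε), |F t - ε * (D * χ ((t - t₀) / ε))| ≤ κ * ε) :
    |D * ∫ r, χ r| ≤ κ := by
  have h1 : ∫ t in Ioo t₀ (t₀ + ε), F t = 0 := by
    rw [← setIntegral_eq_of_subset_of_forall_sdiff_eq_zero hs hJ fun t ht => hFJ t ht.1 ht.2]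
    exact hF0
  have h2 : ∫ t in Ioo t₀ (t₀ + ε), χ ((t - t₀) / ε) = ε * ∫ r, χ r := by
    rw [setIntegral_eq_integral_of_forall_compl_eq_zero]
    · rw [integral_sub_right_eq_self (fun t => χ (t / ε)) t₀]
      have := Measure.integral_comp_mul_left χ ε⁻¹
      rw [inv_inv, abs_of_pos hε, smul_eq_mul] at this
      rw [← this]
      simp only [div_eq_inv_mul]
    · intro t ht
      refine hχ0 _ fun h => ht ?_
      rw [mem_Ioo, lt_div_iff₀ hε, div_lt_iff₀ hε] at h
      exact ⟨by linarith [h.1], by linarith [h.2]⟩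
  have hχi : IntegrableOn (fun t => ε * (D * χ ((t - t₀) / ε))) (Ioo t₀ (t₀ + ε)) :=
    (Continuous.integrableOn_Icc (by fun_prop)).mono_set Ioo_subset_Icc_self
  have h3 : |∫ t in Ioo t₀ (t₀ + ε), (F t - ε * (D * χ ((t - t₀) / ε)))| ≤ κ * ε * ε := by
    have hv : volume.real (Ioo t₀ (t₀ + ε)) = ε := by
      rw [Real.volume_real_Ioo_of_le (by linarith)]; ring
    rw [← Real.norm_eq_abs]
    refine (norm_setIntegral_le_of_norm_le_const (C := κ * ε) measure_Ioo_lt_top hFχ).trans ?_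
    rw [hv]
  rw [integral_sub (hF.mono_set hJ) hχi, h1, integral_const_mul, integral_const_mul, h2, zero_sub,
    abs_neg] at h3
  -- One factor `ε` comes from the size of the integrand, the other from the length of the time
  -- interval; both cancel against the error `κ ε ε`.
  have h4 : |ε * (D * (ε * ∫ r, χ r))| = |D * ∫ r, χ r| * (ε * ε) := by
    rw [← abs_of_pos (mul_pos hε hε), ← abs_mul]
    congr 1; ring
  rw [h4, mul_assoc] at h3
  exact le_of_mul_le_mul_right h3 (by positivity)

/-! ### Measurability of the curve and continuity of the coefficients -/

lemma IsMovingCurve.measurableSet {Ω : Set E3} (hΩ : IsOpen Ω) {Te : ℝ} {ℓ : ℝ → Set E3}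
    {τ : ℝ → E3 → E3} (h : IsMovingCurve Ω Te ℓ τ) {t : ℝ} (ht : t ∈ Ico 0 Te) :
    MeasurableSet (ℓ t) := by
  have : ℓ t = closure (ℓ t) ∩ Ω :=
    Subset.antisymm (subset_inter subset_closure (h.subset t ht)) (h.relClosed t ht)
  rw [this]
  exact isClosed_closure.measurableSet.inter hΩ.measurableSet

lemma HasFirstOrderModel.continuousWithinAt {Te : ℝ} {ℓ : ℝ → Set E3} {τ : ℝ → E3 → E3} {t₀ : ℝ}
    {x₀ p V : E3} (h : HasFirstOrderModel Te ℓ τ t₀ x₀ p V) :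
    ContinuousWithinAt (fun q : ℝ × E3 => τ q.1 q.2) {q | q.1 ∈ Ico 0 Te ∧ q.2 ∈ ℓ q.1}
      (t₀, x₀) := by
  rw [Metric.continuousWithinAt_iff]
  intro κ hκ
  obtain ⟨δ, hδ, H⟩ := h (κ / 2) (by positivity)
  refine ⟨δ, hδ, fun {q} hq hd => ?_⟩
  rw [Prod.dist_eq, max_lt_iff] at hd
  obtain ⟨g, -, -, hg⟩ := H q.1 hq.1 (by rw [← Real.dist_eq]; exact hd.1)
  rw [dist_eq_norm]
  exact ((hg q.2 hd.2).2 hq.2).trans_lt (by linarith)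

lemma continuous_cross : Continuous fun q : E3 × E3 => cross q.1 q.2 := by
  refine (PiLp.continuous_toLp 2 _).comp (continuous_pi fun i => ?_)
  fin_cases i <;> simp [crossProduct] <;> fun_prop

lemma continuous_matVec (b : E3) :
    Continuous fun A : Matrix (Fin 3) (Fin 3) ℝ => matVec A b :=
  (PiLp.continuous_toLp 2 _).comp (continuous_id.matrix_mulVec continuous_const)

lemma exists_norm_sub_le_of_continuousWithinAt {Te : ℝ} {ℓ : ℝ → Set E3} {t₀ : ℝ} {x₀ : E3}
    {A : ℝ → E3 → E3}
    (h : ContinuousWithinAt (fun q : ℝ × E3 => A q.1 q.2) {q | q.1 ∈ Ico 0 Te ∧ q.2 ∈ ℓ q.1}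
      (t₀, x₀)) (κ : ℝ) (hκ : 0 < κ) :
    ∃ δ : ℝ, 0 < δ ∧ ∀ t ∈ Ico 0 Te, |t - t₀| < δ → ∀ y ∈ ℓ t, y ∈ Metric.ball x₀ δ →
      ‖A t y - A t₀ x₀‖ ≤ κ := by
  obtain ⟨δ, hδ, H⟩ := Metric.continuousWithinAt_iff.1 h κ hκ
  refine ⟨δ, hδ, fun t ht htd y hy hyd => ?_⟩
  have := @H (t, y) ⟨ht, hy⟩ (by rw [Prod.dist_eq, Real.dist_eq]; exact max_lt htd hyd)
  rw [dist_eq_norm] at this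
  exact this.le

/-- `α` is continuous only over the unit sphere, so continuity is taken within a set on which `τ`
has norm one. -/
lemma continuousWithinAt_constitutive {α : E3 → E3 → E3}
    (hα : ContinuousOn (fun p : E3 × E3 => α p.1 p.2) (Metric.sphere 0 1 ×ˢ univ))
    {X : Type*} [TopologicalSpace X] {T : X → Matrix (Fin 3) (Fin 3) ℝ} {τ : X → E3} {S : Set X}
    {q : X} (b : E3) (hq : q ∈ S) (hτ : ContinuousWithinAt τ S q) (hT : ContinuousWithinAt T S q)
    (hτ1 : ∀ q ∈ S, ‖τ q‖ = 1) :
    ContinuousWithinAt (fun q => cross (constitutive α b (T q) (τ q)) (τ q)) S q := by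
  have h1 : ContinuousWithinAt (fun q => cross (τ q) (matVec (T q) b)) S q :=
    continuous_cross.continuousAt.comp_continuousWithinAt
      (hτ.prodMk ((continuous_matVec b).continuousAt.comp_continuousWithinAt hT))
  have h2 : ContinuousWithinAt (fun q => constitutive α b (T q) (τ q)) S q :=
    ContinuousWithinAt.comp (f := fun q => (τ q, cross (τ q) (matVec (T q) b)))
      (hα _ ⟨by simp [hτ1 q hq], mem_univ _⟩) (hτ.prodMk h1)
      fun q hq => ⟨by simp [hτ1 q hq], mem_univ _⟩
  exact continuous_cross.continuousAt.comp_continuousWithinAt (h2.prodMk hτ)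

/-! ### The motion law and the conclusion -/

/-- The motion law in a normal direction `n`, by blow-up of the weak formulation. -/
theorem IsWeakSolution.inner_velocity_eq {Ω : Set E3} (hΩ : IsOpen Ω) {Te : ℝ} {b : E3}
    {α : E3 → E3 → E3} {T : ℝ → E3 → Matrix (Fin 3) (Fin 3) ℝ} {ℓ : ℝ → Set E3}
    {τ : ℝ → E3 → E3} (hℓ : IsMovingCurve Ω Te ℓ τ)
    (hsol : IsWeakSolution Ω Te α b T (fun t => curveMeasure b (ℓ t)) τ)
    (hb : b ≠ 0) {t₀ : ℝ} (ht₀ : t₀ ∈ Ico 0 Te) {x₀ : E3} (hx₀ : x₀ ∈ ℓ t₀)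
    (hcont : ContinuousWithinAt
      (fun q : ℝ × E3 => cross (constitutive α b (T q.1 q.2) (τ q.1 q.2)) (τ q.1 q.2))
      {q | q.1 ∈ Ico 0 Te ∧ q.2 ∈ ℓ q.1} (t₀, x₀))
    {c : ℝ} (hc : 0 < c) {V : E3}
    (hmod : HasFirstOrderModel Te ℓ τ t₀ x₀ (c • τ t₀ x₀) V) {n : E3}
    (hn : inner ℝ n (τ t₀ x₀) = 0) :
    inner ℝ n V = inner ℝ n (constitutive α b (T t₀ x₀) (τ t₀ x₀)) := by
  obtain ⟨u, hudef⟩ : ∃ u, u = τ t₀ x₀ := ⟨_, rfl⟩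
  obtain ⟨p, hpdef⟩ : ∃ p, p = c • u := ⟨_, rfl⟩
  obtain ⟨a, hadef⟩ : ∃ a, a = constitutive α b (T t₀ x₀) (τ t₀ x₀) := ⟨_, rfl⟩
  have hu : ‖u‖ = 1 := by rw [hudef]; exact hℓ.unit t₀ ht₀ x₀ hx₀
  have huu : (inner ℝ u u : ℝ) = 1 := by rw [real_inner_self_eq_norm_sq, hu, one_pow]
  have hpn : ‖p‖ = c := by rw [hpdef, norm_smul, hu, mul_one, Real.norm_of_nonneg hc.le]
  rw [← hudef] at hn hmod
  rw [← hpdef] at hmod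
  rw [← hadef]
  have hnp : ∀ s : ℝ, inner ℝ n (s • p) = 0 := fun s => by
    rw [hpdef, inner_smul_right, inner_smul_right, hn, mul_zero, mul_zero]
  have hp : 0 < ‖p‖ := by rw [hpn]; exact hc
  -- The support of `χ` is `[1/4, 3/4]`, so the test field lives strictly inside `(t₀, t₀ + ε)`;
  -- this makes it admissible even for `t₀ = 0`.
  obtain ⟨χ, hχ⟩ : ∃ χ : ContDiffBump (1 / 2 : ℝ), χ.rOut = 1 / 4 :=
    ⟨⟨1 / 8, 1 / 4, by norm_num, by norm_num⟩, rfl⟩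
  obtain ⟨β, hβ⟩ : ∃ β : ContDiffBump (0 : E3), β.rOut = 2 :=
    ⟨⟨1, 2, by norm_num, by norm_num⟩, rfl⟩
  set ψ := profile χ β V n with hψdef
  have hψ : ContDiff ℝ ((⊤ : ℕ∞) : WithTop ℕ∞) ψ := contDiff_profile χ β
  have hψc : HasCompactSupport ψ := hasCompactSupport_profile χ β
  have hψd : Differentiable ℝ ψ := hψ.differentiable (by simp)
  obtain ⟨I, hI⟩ : ∃ I, I = ∫ s : ℝ, β (s • p) := ⟨_, rfl⟩
  have hI0 : 0 < I := by
    have hcomp : HasCompactSupport fun s : ℝ => β (s • p) := by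
      refine HasCompactSupport.intro (isCompact_closedBall (0 : ℝ) (2 / ‖p‖)) fun s hs => ?_
      rw [mem_closedBall_zero_iff, not_le, div_lt_iff₀ hp] at hs
      refine β.zero_of_le_dist ?_
      rw [dist_zero_right, norm_smul, hβ]
      exact hs.le
    have hcon : Continuous fun s : ℝ => β (s • p) := β.continuous.comp (by fun_prop)
    rw [hI]
    refine hcon.integral_pos_of_hasCompactSupport_nonneg_nonzero hcomp
      (fun s => β.nonneg) (x := 0) ?_
    rw [zero_smul]
    exact (β.pos_of_mem_ball (Metric.mem_ball_self β.rOut_pos)).ne'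
  have hχI : 0 < ∫ r, χ r := χ.integral_pos
  have hχ0 : ∀ r, r ∉ Ioo (0 : ℝ) 1 → r ∉ Icc (1 / 2 - χ.rOut) (1 / 2 + χ.rOut) := by
    intro r hr h
    rw [hχ] at h
    exact hr ⟨by linarith [h.1], by linarith [h.2]⟩
  have hχ0' : ∀ r, r ∉ Ioo (0 : ℝ) 1 → χ r = 0 := by
    intro r hr
    by_contra h
    have h1 : r ∈ Function.support χ := h
    rw [χ.support_eq, Metric.mem_ball, Real.dist_eq, abs_lt, hχ] at h1
    exact hr ⟨by linarith, by linarith⟩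
  -- `D` is the coefficient of `χ` in the limit. `‖b‖` is the density of the curve measure, one
  -- factor `c = ‖p‖` comes from arc length and the other from the direction `p = c u` of the test
  -- field.
  obtain ⟨D, hD⟩ : ∃ D, D = ‖b‖ * c * (c * I * (inner ℝ n a - inner ℝ n V)) := ⟨_, rfl⟩
  suffices hD0 : D * ∫ r, χ r = 0 by
    have h1 : D = 0 := (mul_eq_zero.1 hD0).resolve_right hχI.ne'
    rw [hD] at h1
    have h2 : ‖b‖ ≠ 0 := norm_ne_zero_iff.2 hb
    have h3 := (mul_eq_zero.1 h1).resolve_left (mul_ne_zero h2 hc.ne')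
    have h4 := (mul_eq_zero.1 h3).resolve_left (mul_ne_zero hc.ne' hI0.ne')
    linarith
  rw [← abs_nonpos_iff]
  refine le_of_forall_pos_le_add fun κ' hκ' => ?_
  rw [zero_add]
  obtain ⟨κ, hκ, hκκ⟩ : ∃ κ : ℝ, 0 < κ ∧ ‖b‖ * (2 * κ) ≤ κ' := by
    refine ⟨κ' / (2 * ‖b‖), by positivity, le_of_eq ?_⟩
    field_simp
  obtain ⟨L₁, M₁, R₁, hR₁, hL₁, hM₁, hz₁⟩ :=
    exists_bounds_comp_fderiv hψ hψc (contDiff_timePart p) (timePart_zero p)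
  obtain ⟨L₂, M₂, R₂, hR₂, hL₂, hM₂, hz₂⟩ :=
    exists_bounds_comp_fderiv hψ hψc (contDiff_curlPart p) (curlPart_zero p)
  obtain ⟨ε₁, hε₁, H₁⟩ := hmod.exists_blowUp_estimate hp (fun t ht => hℓ.measurableSet hΩ ht)
    (exists_norm_sub_le_of_continuousWithinAt hmod.continuousWithinAt) hL₁ hM₁ hR₁ hz₁ hκ
  obtain ⟨ε₂, hε₂, H₂⟩ := hmod.exists_blowUp_estimate hp (fun t ht => hℓ.measurableSet hΩ ht)
    (A := fun t y => cross (constitutive α b (T t y) (τ t y)) (τ t y))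
    (exists_norm_sub_le_of_continuousWithinAt hcont) hL₂ hM₂ hR₂ hz₂ hκ
  obtain ⟨ρ, hρ, hρΩ⟩ := Metric.isOpen_iff.1 hΩ x₀ (hℓ.subset t₀ ht₀ hx₀)
  obtain ⟨R, hR⟩ : ∃ R, R = β.rOut + (1 / 2 + χ.rOut) * ‖V‖ := ⟨_, rfl⟩
  have hR0 : 0 < R := by rw [hR, hβ, hχ]; positivity
  obtain ⟨ε, hε, hεε₁, hεε₂, hεT, hεR⟩ : ∃ ε : ℝ, 0 < ε ∧ ε < ε₁ ∧ ε < ε₂ ∧ ε < Te - t₀ ∧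
      ε < ρ / R := by
    obtain ⟨ε, h1, h2⟩ := exists_between (show 0 < min (min ε₁ ε₂) (min (Te - t₀) (ρ / R)) by
      have : 0 < Te - t₀ := sub_pos.2 ht₀.2
      positivity)
    simp only [lt_min_iff] at h2
    exact ⟨ε, h1, h2.1.1, h2.1.2, h2.2.1, h2.2.2⟩
  have hφ : IsSpaceTimeTestField Te Ω (rescaledField ψ p x₀ t₀ ε) := by
    refine isSpaceTimeTestField_rescaledField hψ (fun r z h => profile_support χ β h) hε ?_ ?_ ?_
    · have := ht₀.1
      rw [hχ]; nlinarith
    · rw [hχ]; nlinarith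
    · refine (Metric.closedBall_subset_ball ?_).trans hρΩ
      rw [← hR]
      exact (lt_div_iff₀ hR0).1 hεR
  have hP : ∀ t, pairing (curveMeasure b (ℓ t)) (τ t)
      (fun x => deriv (fun r => rescaledField ψ p x₀ t₀ ε r x) t) =
      ‖b‖ * ∫ y in ℓ t, inner ℝ (τ t y)
        (timePart p (fderiv ℝ ψ ((t - t₀) / ε, ε⁻¹ • (y - x₀))))
        ∂(Measure.hausdorffMeasure 1 : Measure E3) := by
    intro t
    simp only [pairing_curveMeasure, deriv_rescaledField hψd hε.ne']
  have hQ : ∀ t, pairing (curveMeasure b (ℓ t))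
      (fun x => cross (constitutive α b (T t x) (τ t x)) (τ t x))
      (rot (rescaledField ψ p x₀ t₀ ε t)) =
      ‖b‖ * ∫ y in ℓ t, inner ℝ (cross (constitutive α b (T t y) (τ t y)) (τ t y))
        (curlPart p (fderiv ℝ ψ ((t - t₀) / ε, ε⁻¹ • (y - x₀))))
        ∂(Measure.hausdorffMeasure 1 : Measure E3) := by
    intro t
    simp only [pairing_curveMeasure, rot_rescaledField hψd hε.ne']
  have hi₁ := hsol.integrableOn_left _ hφ
  have hi₂ := hsol.integrableOn_right _ hφ
  have heq := hsol.equation _ hφ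
  have hj₁ := hsol.integrable_left _ hφ
  have hj₂ := hsol.integrable_right _ hφ
  simp only [deriv_rescaledField hψd hε.ne'] at hj₁
  simp only [rot_rescaledField hψd hε.ne'] at hj₂
  simp only [hP] at hi₁ heq
  simp only [hQ] at hi₂ heq
  refine (abs_mul_integral_le_of_integral_eq_zero (t₀ := t₀) (s := Ioo 0 Te) hε χ.continuous hχ0'
    measurableSet_Ioo ?_ (hi₁.add hi₂) ?_ ?_ ?_).trans hκκ
  · intro t ht
    exact ⟨ht₀.1.trans_lt ht.1, by linarith [ht.2]⟩
  · rw [integral_add' hi₁ hi₂]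
    linarith
  · intro t _ htJ
    have hr : (t - t₀) / ε ∉ Ioo (0 : ℝ) 1 := by
      intro h
      rw [mem_Ioo, lt_div_iff₀ hε, div_lt_iff₀ hε] at h
      exact htJ ⟨by linarith [h.1], by linarith [h.2]⟩
    have h0 : ∀ z, fderiv ℝ ψ ((t - t₀) / ε, z) = 0 :=
      fderiv_profile_eq_zero χ β (hχ0 _ hr)
    simp [h0, timePart_zero, curlPart_zero]
  · intro t ht
    have htI : t ∈ Ioo 0 Te := ⟨ht₀.1.trans_lt ht.1, by linarith [ht.2]⟩
    have E₁ := H₁ ε hε hεε₁ t ⟨htI.1.le, htI.2⟩ ht.1.le ht.2.le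
      (integrable_of_integrable_curveMeasure hb (hj₁ t htI))
    have E₂ := H₂ ε hε hεε₂ t ⟨htI.1.le, htI.2⟩ ht.1.le ht.2.le
      (integrable_of_integrable_curveMeasure hb (hj₂ t htI))
    rw [← hudef] at E₁ E₂
    rw [hudef, ← hadef, ← hudef] at E₂
    have F₁ : ∫ s : ℝ, (inner ℝ u (timePart p (fderiv ℝ ψ ((t - t₀) / ε,
        s • p + ((t - t₀) / ε) • V))) : ℝ) = -(χ ((t - t₀) / ε) * inner ℝ n V * c * I) := by
      have : ∀ s : ℝ, (inner ℝ u (timePart p (fderiv ℝ ψ ((t - t₀) / ε,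
          s • p + ((t - t₀) / ε) • V))) : ℝ) =
          -(χ ((t - t₀) / ε) * inner ℝ n V * c) * β (s • p) := by
        intro s
        rw [timePart_fderiv_profile χ β p (hnp s), hpdef]
        simp only [inner_smul_right, huu]
        ring
      simp only [this, integral_const_mul, ← hI]
      ring
    have F₂ : ∫ s : ℝ, (inner ℝ (cross a u) (curlPart p (fderiv ℝ ψ ((t - t₀) / ε,
        s • p + ((t - t₀) / ε) • V))) : ℝ) = χ ((t - t₀) / ε) * inner ℝ n a * c * I := by
      have : ∀ s : ℝ, (inner ℝ (cross a u) (curlPart p (fderiv ℝ ψ ((t - t₀) / ε,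
          s • p + ((t - t₀) / ε) • V))) : ℝ) =
          (χ ((t - t₀) / ε) * inner ℝ n a * c) * β (s • p) := by
        intro s
        -- `(a × u) · (n × p) = (a · n)(u · p) - (u · n)(a · p)`, and the second term vanishes
        -- because `n ⊥ u`.
        rw [curlPart_fderiv_profile χ β p (hnp s), inner_smul_right, inner_cross_cross, hpdef]
        simp only [inner_smul_right, huu, real_inner_comm n u, hn, real_inner_comm n a]
        ring
      simp only [this, integral_const_mul, ← hI]
    rw [F₁, hpn] at E₁
    rw [F₂, hpn] at E₂
    have hbn := norm_nonneg b
    refine le_trans (le_of_eq ?_) ((mul_le_mul_of_nonneg_left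
      ((abs_add_le _ _).trans (add_le_add E₁ E₂)) hbn).trans (le_of_eq (by ring)))
    rw [← abs_of_nonneg hbn, ← abs_mul, abs_of_nonneg hbn, hD]
    congr 1
    simp only [Pi.add_apply]
    ring

end

theorem corollary3p4
    (Ω : Set E3) (hΩ : IsOpen Ω) (Te : ℝ) (b : E3)
    (α : E3 → E3 → E3)
    (hα : ContinuousOn (fun p : E3 × E3 => α p.1 p.2) (Metric.sphere 0 1 ×ˢ univ))
    (T : ℝ → E3 → Matrix (Fin 3) (Fin 3) ℝ)
    (hTsymm : ∀ t ∈ Ico 0 Te, ∀ x ∈ Ω, (T t x).IsSymm)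
    (hTcont : ∀ t ∈ Ico 0 Te, ContinuousOn (T t) (closure Ω))
    (ℓ : ℝ → Set E3) (τ : ℝ → E3 → E3)
    (hℓ : IsMovingCurve Ω Te ℓ τ)
    (hsol : IsWeakSolution Ω Te α b T (fun t => curveMeasure b (ℓ t)) τ)
    (t : ℝ) (ht : t ∈ Ico 0 Te) (x : E3) (hx : x ∈ ℓ t)
    (hTat : ContinuousWithinAt (fun p : ℝ × E3 => T p.1 p.2) (Ico 0 Te ×ˢ Ω) (t, x))
    (hvol : inner ℝ b (cross (constitutive α b (T t x) (τ t x)) (τ t x)) = 0)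
    (hb : ¬ IsParallelTo b (τ t x)) :
    (∃ v : E3, HasNormalVelocity Te ℓ τ t x v) ∧
      ∀ v : E3, HasNormalVelocity Te ℓ τ t x v → IsParallelTo v (projPerp (τ t x) b) := by
  obtain ⟨c, hc, V, hmod⟩ := hℓ.exists_hasFirstOrderModel ht hx
  have hu := hℓ.unit t ht x hx
  have hvel := hmod.hasNormalVelocity hc ht hu
  refine ⟨⟨_, hvel⟩, fun v hv => ?_⟩
  rw [hv.unique ht hvel]
  -- For `b = 0` the curve measure is zero and the weak equation would carry no information.
  have hb0 : b ≠ 0 := fun h => hb (by rw [h]; exact Submodule.zero_mem _)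
  have hcont := continuousWithinAt_constitutive (X := ℝ × E3) (τ := fun q => τ q.1 q.2)
    (T := fun q => T q.1 q.2) (q := (t, x))
    (S := {q | q.1 ∈ Ico 0 Te ∧ q.2 ∈ ℓ q.1}) hα b ⟨ht, hx⟩ hmod.continuousWithinAt
    (hTat.mono fun q hq => ⟨hq.1, hℓ.subset _ hq.1 hq.2⟩) fun q hq => hℓ.unit _ hq.1 _ hq.2
  have hn : (inner ℝ (cross (τ t x) b) (τ t x) : ℝ) = 0 := inner_cross_self_left _ _
  refine isParallelTo_projPerp hu hb ?_ ?_
  · rw [inner_sub_left, inner_smul_left, real_inner_self_eq_norm_sq, hu]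
    simp
  -- The motion law is used with `n = τ × b`: the tangential part of `V` drops out, and cyclicity of
  -- the triple product produces the assumption on `b`.
  · rw [inner_sub_right, inner_smul_right, hn, mul_zero, sub_zero,
      hsol.inner_velocity_eq hΩ hℓ hb0 ht hx hcont hc hmod hn, ← inner_cross_cyclic]
    exact hvol
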